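/- **Setting.** Let $\mathcal G^0=(\mathcal V,\mathcal E^0)$, $\mathcal V=\{1,\dots,N\}$, be an undirected graph without self-loops, given by its set $\mathcal E^0\subset\mathcal V\times\mathcal V$ of ordered edges $(i,j)$ (pointing from $j$ to $i$), so $(i,j)\in\mathcal E^0\Leftrightarrow(j,i)\in\mathcal E^0$. For an edge set $\mathcal E$ the Laplacian $L(\mathcal E)\in\mathbb R^{N\times N}$ has off-diagonal entries $-1$ if $(i,j)\in\mathcal E$ and $0$ otherwise, and zero row sums. Put $L^0=L(\mathcal E^0)$, with eigenvalues $\lambda_1,\dots,\lambda_N$ (with multiplicity). Let $\mathcal K$ be a set of subsets of $\mathcal E^0$ (the modes, i.e. the possible sets of successfully transmitting links), and let $(\sigma_k)_{k\ge0}$ be a homogeneous Markov chain on $\mathcal K$ with transition probabilities $t_{EE'}$ and initial distribution $\mu$. Write $\theta^{ij}_k=1$ if $(i,j)\in\sigma_k$ and $\theta^{ij}_k=0$ otherwise. The decomposable Markov jump linear system $G$ is $$x_{k+1}=A_{\sigma_k}x_k+B_{\sigma_k}w_k,\qquad z_k=C_{\sigma_k}x_k+D_{\sigma_k}w_k,$$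 with $x_k\in\mathbb R^{Nn_x}$, $w_k\in\mathbb R^{Nn_w}$, $z_k\in\mathbb R^{Nn_z}$, where for every mode $E$ $$A_E=I_N\otimes A^d+L(E)\otimes A^c+L^0\otimes A^p,$$ and likewise for $B_E,C_E,D_E$. It is *mean-square stable* if for $w=0$, all $x_0$ and all $\sigma_0\in\mathcal K$, $\mathbb E\|x_k\|\to0$ and $\mathbb E\|x_kx_k^\top\|\to0$ as $k\to\infty$. Its $\mathcal H_2$-norm is given by $$\|G\|_{\mathcal H_2}^2=\sum_{E\in\mathcal K}\sum_{s=1}^{Nn_w}\mu_E\sum_{k\ge0}\mathbb E\big[(z_k^{s,E})^\top z_k^{s,E}\big]\in[0,\infty],$$ where $z^{s,E}$ is the response to a discrete impulse at time $0$ at the $s$-th input with $\sigma_0=E$, $x_0=0$. **Packet loss.** For every initial mode, and for the initial distribution $\mu$: for all $k\ge0$ and $(i,j)\in\mathcal E^0$, $$\mathbb P(\theta^{ij}_{k+1}=1\mid\theta^{ij}_k=1)=p^{ij},\qquad \mathbb P(\theta^{ij}_{k+1}=1\mid\theta^{ij}_k=0)=q^{ij}$$ whenever the conditioning event has positive probability,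 and $\theta^{ij}_k$, $\theta^{rs}_{k'}$ are independent for all $k,k'\ge0$ whenever $(i,j),(r,s)\in\mathcal E^0$ belong to different pairs of agents, i.e. $(i,j)\ne(r,s)\ne(j,i)$. Under the initial distribution $\mu$, $\mathbb P(\theta^{ij}_0=1)=\eta^{ij}$. The probabilities are symmetric, $p^{ij}=p^{ji}$, $q^{ij}=q^{ji}$, $\eta^{ij}=\eta^{ji}$, and either (i) the loss is symmetric, $\theta_k^{ij}=\theta_k^{ji}$ almost surely for all $k$ and every initial mode, or (ii) it is Bernoulli, $p^{ij}=q^{ij}$ for all $(i,j)\in\mathcal E^0$. Moreover $0\le\rho_l\le\rho_u\le1$ and $p^{ij},q^{ij},\eta^{ij}\in[\rho_l,\rho_u]$ for all $(i,j)\in\mathcal E^0$. **Multipliers.** Let $$\boldsymbol\Delta=\left\{\begin{bmatrix}a&0\\b&0\\0&a\end{bmatrix}\;:\;a,b\ge0,\ a^2\in[\rho_l,\rho_u],\ b^2=1-a^2\right\},$$ $$\mathcal P_\alpha=\left\{P=P^\top\in\mathbb R^{5\alpha\times5\alpha}\;:\;\begin{bmatrix}\Delta\otimes I_\alpha\\I_{2\alpha}\end{bmatrix}^\top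 P\begin{bmatrix}\Delta\otimes I_\alpha\\I_{2\alpha}\end{bmatrix}\succ0\ \ \forall\Delta\in\boldsymbol\Delta\right\}.$$ With $\alpha=n_x+n_z$ let $\mathcal B_j$ be the $j$-th block row of $I_3\otimes I_\alpha$ ($j=1,2,3$). For $\lambda>0$, a symmetric $S\in\mathbb R^{n\times n}$, a symmetric $Y\in\mathbb R^{n_x\times n_x}$, $F^d,F^c,F^p\in\mathbb R^{\alpha\times n}$ and $P\in\mathbb R^{5\alpha\times5\alpha}$ put $$\mathcal M_\lambda(S,Y,F,P)=\begin{bmatrix}I&0\\F^d+\lambda F^p&\sqrt\lambda\,\mathcal B_1\\0&\mathcal B_2\end{bmatrix}^\top\begin{bmatrix}-S&&\\&H&\\&&2H\end{bmatrix}\begin{bmatrix}I&0\\F^d+\lambda F^p&\sqrt\lambda\,\mathcal B_1\\0&\mathcal B_2\end{bmatrix}+\begin{bmatrix}0&I\\0&\mathcal B_3\\\sqrt\lambda F^c&0\end{bmatrix}^\top P\begin{bmatrix}0&I\\0&\mathcal B_3\\\sqrt\lambda F^c&0\end{bmatrix},\quad H=\begin{bmatrix}Y&0\\0&I_{n_z}\end{bmatrix}.$$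 **Theorem ($\mathcal H_2$-norm bound).** Let $\gamma>0$. Suppose there exist $Y\succ0$, symmetric $Z_1,\dots,Z_N\in\mathbb R^{n_w\times n_w}$ with $\sum_{i=1}^N\operatorname{tr}Z_i<\gamma^2$, and $P_1,P_2\in\mathcal P_{n_x+n_z}$ such that - for all $i$ with $\lambda_i=0$: $\;A^{d\top}YA^d-Y+C^{d\top}C^d\prec0$ and $B^{d\top}YB^d-Z_i+D^{d\top}D^d\prec0$; - for all $i$ with $\lambda_i\neq0$: $\;\mathcal M_{\lambda_i}\big(Y,Y,\begin{bmatrix}A\\C\end{bmatrix},P_1\big)\prec0$ and $\mathcal M_{\lambda_i}\big(Z_i,Y,\begin{bmatrix}B\\D\end{bmatrix},P_2\big)\prec0$, where $\begin{bmatrix}A\\C\end{bmatrix}$ stands for the triple $F^\bullet=\begin{bmatrix}A^\bullet\\C^\bullet\end{bmatrix}$, $\bullet\in\{d,c,p\}$, and similarly for $\begin{bmatrix}B\\D\end{bmatrix}$. Then $G$ is mean-square stable and $\|G\|_{\mathcal H_2}<\gamma$. -/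

import Mathlib

open scoped Kronecker Matrix
open MeasureTheory

noncomputable section

/-! ### Markov jump linear systems -/

/-- A Markov jump linear system with finite mode set `K`, state indices `X`, input indices `W`
and output indices `Z`: the system matrices of each mode, the transition probabilities `t` and
the initial distribution `μ` of the mode process. -/
structure MJLS (K X W Z : Type*) [Fintype K] where
  A : K → Matrix X X ℝ
  B : K → Matrix X W ℝ
  C : K → Matrix Z X ℝ
  D : K → Matrix Z W ℝ
  t : K → K → ℝ
  μ : K → ℝ
  t_nonneg : ∀ i j, 0 ≤ t i j
  t_sum : ∀ i, ∑ j, t i j = 1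
  μ_nonneg : ∀ i, 0 ≤ μ i
  μ_sum : ∑ i, μ i = 1

/-- `σ` is, under each of the probability measures `P i`, a Markov chain with transition
probabilities `t` that starts in the mode `i`. -/
structure IsMarkovFamily {K Ω : Type*} [MeasurableSpace Ω] (t : K → K → ℝ)
    (P : K → Measure Ω) (σ : ℕ → Ω → K) : Prop where
  prob : ∀ i, IsProbabilityMeasure (P i)
  meas : ∀ k j, MeasurableSet {ω | σ k ω = j}
  start : ∀ i, P i {ω | σ 0 ω = i} = 1
  markov : ∀ i k (c : ℕ → K),
    (P i).real {ω | ∀ l ≤ k + 1, σ l ω = c l} =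
      (P i).real {ω | ∀ l ≤ k, σ l ω = c l} * t (c k) (c (k + 1))

/-- The law with random initial mode of distribution `μ`, that is `∑ i, μ i • P i`. -/
def mixLaw {K Ω : Type*} [Fintype K] [MeasurableSpace Ω] (μ : K → ℝ) (P : K → Measure Ω) :
    Measure Ω :=
  ∑ i, ENNReal.ofReal (μ i) • P i

namespace MJLS

variable {K X W Z : Type*} [Fintype K] [Fintype X] [Fintype W] [Fintype Z]

/-- The state `x k` along the mode sequence `s`, from the initial state `x₀` with input `w`. -/
def state (G : MJLS K X W Z) (s : ℕ → K) (x₀ : X → ℝ) (w : ℕ → W → ℝ) : ℕ → X → ℝ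
  | 0 => x₀
  | k + 1 => G.A (s k) *ᵥ state G s x₀ w k + G.B (s k) *ᵥ w k

/-- The output `z k` along the mode sequence `s`, from the initial state `x₀` with input `w`. -/
def output (G : MJLS K X W Z) (s : ℕ → K) (x₀ : X → ℝ) (w : ℕ → W → ℝ) (k : ℕ) : Z → ℝ :=
  G.C (s k) *ᵥ G.state s x₀ w k + G.D (s k) *ᵥ w k

/-- Mean-square stability: for the unforced system, the expectations of the Euclidean norm of
`x k` and of the spectral norm of `x k * (x k)ᵀ` tend to zero, for all initial states and all
initial modes. (The integrands take finitely many values, so they are integrable.) -/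
def IsMeanSquareStable {Ω : Type*} [MeasurableSpace Ω] [DecidableEq X] (G : MJLS K X W Z)
    (P : K → Measure Ω) (σ : ℕ → Ω → K) : Prop :=
  ∀ (x₀ : X → ℝ) (i : K),
    Filter.Tendsto
      (fun k => ∫ ω, ‖WithLp.toLp 2 (G.state (fun l => σ l ω) x₀ 0 k)‖ ∂(P i))
      Filter.atTop (nhds 0) ∧
    Filter.Tendsto
      (fun k => ∫ ω, ‖Matrix.toEuclideanCLM (n := X) (𝕜 := ℝ)
        (Matrix.vecMulVec (G.state (fun l => σ l ω) x₀ 0 k)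
          (G.state (fun l => σ l ω) x₀ 0 k))‖ ∂(P i))
      Filter.atTop (nhds 0)

/-- The discrete impulse at the input component `s`. -/
def impulse [DecidableEq W] (s : W) (k : ℕ) : W → ℝ :=
  if k = 0 then Pi.single s 1 else 0

/-- The squared signal norm `∑ k, E[z_kᵀ z_k]` of the response `z` to an impulse at the input
component `s` with initial mode `i` and zero initial state. -/
def impulseEnergy {Ω : Type*} [MeasurableSpace Ω] [DecidableEq W] (G : MJLS K X W Z)
    (P : K → Measure Ω) (σ : ℕ → Ω → K) (s : W) (i : K) : ENNReal :=
  ∑' k, ∫⁻ ω, ENNReal.ofReal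
    (G.output (fun l => σ l ω) 0 (impulse s) k ⬝ᵥ G.output (fun l => σ l ω) 0 (impulse s) k)
    ∂(P i)

/-- The `H₂`-norm, with values in `[0, ∞]`. -/
def h2Norm {Ω : Type*} [MeasurableSpace Ω] [DecidableEq W] (G : MJLS K X W Z)
    (P : K → Measure Ω) (σ : ℕ → Ω → K) : ENNReal :=
  (∑ i, ∑ s, ENNReal.ofReal (G.μ i) * G.impulseEnergy P σ s i) ^ (1 / 2 : ℝ)

end MJLS

/-! ### Graphs, Laplacians and decomposable systems

A graph on `Fin N` is given by its set of edges; the edge `(i, j)` points from `j` to `i`. -/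

/-- The Laplacian of the graph with edge set `E`. -/
def laplacian {N : ℕ} (E : Finset (Fin N × Fin N)) : Matrix (Fin N) (Fin N) ℝ :=
  Matrix.of fun i j =>
    if i = j then -∑ l ∈ Finset.univ.erase i, (if (i, l) ∈ E then (-1 : ℝ) else 0)
    else if (i, j) ∈ E then -1 else 0

/-- The graph with edge set `E` is undirected. -/
def IsUndirected {N : ℕ} (E : Finset (Fin N × Fin N)) : Prop :=
  ∀ i j, (i, j) ∈ E ↔ (j, i) ∈ E

theorem IsUndirected.isHermitian_laplacian {N : ℕ} {E : Finset (Fin N × Fin N)}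
    (h : IsUndirected E) : (laplacian E).IsHermitian := by
  ext i j
  by_cases hij : i = j
  · subst hij
    simp [Matrix.conjTranspose_apply]
  · have hji : ¬ j = i := fun e => hij e.symm
    have hE := h i j
    simp [Matrix.conjTranspose_apply, laplacian, hij, hji, hE]

/-- The decoupled, coupled (through the random Laplacian) and deterministically coupled
(through the nominal Laplacian) components of a decomposable matrix. -/
structure Components (m n : ℕ) where
  d : Matrix (Fin m) (Fin n) ℝ
  c : Matrix (Fin m) (Fin n) ℝ
  p : Matrix (Fin m) (Fin n) ℝ

/-- `I ⊗ Mᵈ + L ⊗ Mᶜ + L⁰ ⊗ Mᵖ`, where `L` and `L⁰` are the Laplacians of `E` and `E₀`. -/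
def Components.assemble {N m n : ℕ} (M : Components m n) (E₀ E : Finset (Fin N × Fin N)) :
    Matrix (Fin N × Fin m) (Fin N × Fin n) ℝ :=
  (1 : Matrix (Fin N) (Fin N) ℝ) ⊗ₖ M.d + laplacian E ⊗ₖ M.c + laplacian E₀ ⊗ₖ M.p

/-- `G` is the decomposable system with nominal graph `E₀` and components `A`, `B`, `C`, `D`.
Its modes are edge sets: the mode `E` means that exactly the links in `E` transmit. -/
structure IsDecomposable {N nx nw nz : ℕ} {modes : Finset (Finset (Fin N × Fin N))}
    (G : MJLS modes (Fin N × Fin nx) (Fin N × Fin nw) (Fin N × Fin nz))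
    (E₀ : Finset (Fin N × Fin N)) (A : Components nx nx) (B : Components nx nw)
    (C : Components nz nx) (D : Components nz nw) : Prop where
  eq_A : ∀ E : modes, G.A E = A.assemble E₀ E
  eq_B : ∀ E : modes, G.B E = B.assemble E₀ E
  eq_C : ∀ E : modes, G.C E = C.assemble E₀ E
  eq_D : ∀ E : modes, G.D E = D.assemble E₀ E

/-! ### Packet loss -/

section PacketLoss

variable {N : ℕ} {modes : Finset (Finset (Fin N × Fin N))} {Ω : Type*} [MeasurableSpace Ω]

/-- The transmission process of the link `(i, j)`: is the packet received at time `k`? -/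
def link (σ : ℕ → Ω → modes) (i j : Fin N) (k : ℕ) (ω : Ω) : Bool :=
  decide ((i, j) ∈ (σ k ω : Finset (Fin N × Fin N)))

/-- Under the law `Q`, the link processes have transition probabilities `p` (from success to
success) and `q` (from failure to success), and links of distinct pairs of agents are
independent. -/
structure HasLossLaw (E₀ : Finset (Fin N × Fin N)) (p q : Fin N → Fin N → ℝ)
    (σ : ℕ → Ω → modes) (Q : Measure Ω) : Prop where
  success : ∀ i j, (i, j) ∈ E₀ → ∀ k, Q {ω | link σ i j k ω = true} ≠ 0 →
    (ProbabilityTheory.cond Q {ω | link σ i j k ω = true}).real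
      {ω | link σ i j (k + 1) ω = true} = p i j
  failure : ∀ i j, (i, j) ∈ E₀ → ∀ k, Q {ω | link σ i j k ω = false} ≠ 0 →
    (ProbabilityTheory.cond Q {ω | link σ i j k ω = false}).real
      {ω | link σ i j (k + 1) ω = true} = q i j
  indep : ∀ i j r s, (i, j) ∈ E₀ → (r, s) ∈ E₀ → (i, j) ≠ (r, s) → (r, s) ≠ (j, i) →
    ∀ k k', ProbabilityTheory.IndepFun (link σ i j k) (link σ r s k') Q

/-- Markovian packet loss on the links of `E₀` with transition probabilities `p`, `q`, whatever
the initial mode, and with initial success probabilities `η` under the initial distribution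
`μ`. -/
structure IsMarkovLoss (E₀ : Finset (Fin N × Fin N)) (p q η : Fin N → Fin N → ℝ)
    (μ : modes → ℝ) (P : modes → Measure Ω) (σ : ℕ → Ω → modes) : Prop where
  modes_subset : ∀ E ∈ modes, E ⊆ E₀
  law : ∀ E, HasLossLaw E₀ p q σ (P E)
  law_mix : HasLossLaw E₀ p q σ (mixLaw μ P)
  init : ∀ i j, (i, j) ∈ E₀ → (mixLaw μ P).real {ω | link σ i j 0 ω = true} = η i j

/-- Symmetric probabilities, and loss that is either symmetric or independent in time. -/
structure IsSymmetricLoss (E₀ : Finset (Fin N × Fin N)) (p q η : Fin N → Fin N → ℝ)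
    (P : modes → Measure Ω) (σ : ℕ → Ω → modes) : Prop where
  symm_p : ∀ i j, (i, j) ∈ E₀ → p i j = p j i
  symm_q : ∀ i j, (i, j) ∈ E₀ → q i j = q j i
  symm_η : ∀ i j, (i, j) ∈ E₀ → η i j = η j i
  symm_or_bernoulli :
    (∀ E k i j, (i, j) ∈ E₀ → ∀ᵐ ω ∂(P E), link σ i j k ω = link σ j i k ω) ∨
    (∀ i j, (i, j) ∈ E₀ → p i j = q i j)

end PacketLoss

/-! ### Multipliers and linear matrix inequalities -/

/-- `M ≺ 0`: `M` is symmetric and negative definite. -/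
def NegDef {ι : Type*} (M : Matrix ι ι ℝ) : Prop := (-M).PosDef

/-- The uncertainty set of a single link. -/
def uncertaintySet (ρl ρu : ℝ) : Set (Matrix (Fin 3) (Fin 2) ℝ) :=
  {Δ | ∃ a b : ℝ, 0 ≤ a ∧ 0 ≤ b ∧ a ^ 2 ∈ Set.Icc ρl ρu ∧ b ^ 2 = 1 - a ^ 2 ∧
    Δ = !![a, 0; b, 0; 0, a]}

section LMI

variable {ι v : Type*} [Fintype ι] [DecidableEq ι] [Fintype v] [DecidableEq v]

/-- The matrix with the two blocks `Δ ⊗ I` and `I` on top of each other. -/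
def uncertaintyFactor (ι : Type*) [DecidableEq ι] (Δ : Matrix (Fin 3) (Fin 2) ℝ) :
    Matrix ((Fin 3 × ι) ⊕ (Fin 2 × ι)) (Fin 2 × ι) ℝ :=
  Matrix.fromRows (Δ ⊗ₖ (1 : Matrix ι ι ℝ)) (1 : Matrix (Fin 2 × ι) (Fin 2 × ι) ℝ)

/-- The multiplier set, for an exchanged signal with components indexed by `ι`. -/
def multiplierSet (ι : Type*) [Fintype ι] [DecidableEq ι] (ρl ρu : ℝ) :
    Set (Matrix ((Fin 3 × ι) ⊕ (Fin 2 × ι)) ((Fin 3 × ι) ⊕ (Fin 2 × ι)) ℝ) :=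
  {P | P.IsSymm ∧ ∀ Δ ∈ uncertaintySet ρl ρu,
    ((uncertaintyFactor ι Δ)ᵀ * P * uncertaintyFactor ι Δ).PosDef}

/-- The block row number `j` of the identity matrix on `Fin 3 × ι`. -/
def blockRow (ι : Type*) [DecidableEq ι] (j : Fin 3) : Matrix ι (Fin 3 × ι) ℝ :=
  (1 : Matrix (Fin 3 × ι) (Fin 3 × ι) ℝ).submatrix (fun a => (j, a)) id

/-- Two blocks on top of each other. -/
def stack {κ : Type*} (M₁ M₂ : Matrix ι κ ℝ) : Matrix (Fin 2 × ι) κ ℝ :=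
  Matrix.of fun r c => (![M₁, M₂] r.1) r.2 c

/-- The outer factor with rows `[I, 0]`, `[Fᵈ + lam Fᵖ, √lam 𝓑₁]`, `[0, 𝓑₂]`. -/
def outerFactor (lam : ℝ) (Fd Fp : Matrix ι v ℝ) :
    Matrix (v ⊕ (ι ⊕ ι)) (v ⊕ (Fin 3 × ι)) ℝ :=
  Matrix.fromBlocks 1 0
    (Matrix.fromRows (Fd + lam • Fp) 0)
    (Matrix.fromRows (Real.sqrt lam • blockRow ι 0) (blockRow ι 1))

/-- The centre matrix `diag(-S, H, 2 H)`. -/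
def centreMatrix (S : Matrix v v ℝ) (H : Matrix ι ι ℝ) :
    Matrix (v ⊕ (ι ⊕ ι)) (v ⊕ (ι ⊕ ι)) ℝ :=
  Matrix.fromBlocks (-S) 0 0 (Matrix.fromBlocks H 0 0 ((2 : ℝ) • H))

/-- The outer factor of the multiplier, with rows `[0, I]`, `[0, 𝓑₃]`, `[√lam Fᶜ, 0]`. -/
def multiplierFactor (lam : ℝ) (Fc : Matrix ι v ℝ) :
    Matrix ((Fin 3 × ι) ⊕ (Fin 2 × ι)) (v ⊕ (Fin 3 × ι)) ℝ :=
  Matrix.fromBlocks 0 1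
    (stack 0 (Real.sqrt lam • Fc))
    (stack (blockRow ι 2) 0)

/-- The left-hand side of the modal matrix inequalities. -/
def modalMatrix (lam : ℝ) (S : Matrix v v ℝ) (H : Matrix ι ι ℝ) (Fd Fc Fp : Matrix ι v ℝ)
    (P : Matrix ((Fin 3 × ι) ⊕ (Fin 2 × ι)) ((Fin 3 × ι) ⊕ (Fin 2 × ι)) ℝ) :
    Matrix (v ⊕ (Fin 3 × ι)) (v ⊕ (Fin 3 × ι)) ℝ :=
  (outerFactor lam Fd Fp)ᵀ * centreMatrix S H * outerFactor lam Fd Fp +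
    (multiplierFactor lam Fc)ᵀ * P * multiplierFactor lam Fc

end LMI

end

/-!
Since the mode `σ k` acts on the state `x k` only one step later, it is enough to control the mean
of the energy after one step over the law of the next mode. The function `V x = xᵀ (I ⊗ Y) x`
satisfies, for every mode `E` and some `ε > 0`,
`∑ E', t E E' * (V (A_E' x) + ‖C_E' x‖²) + ε ‖x‖² ≤ V x`.
Summing this along the chain from time one on gives mean-square stability and bounds the energy of
an impulse response by `V (B_E e_s) + ‖D_E e_s‖²` (`MJLS.sum_energy_le`); the mean of this bound
over the initial distribution, summed over the inputs `s`, is at most `∑ i, tr (Z i)`.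

Both estimates are instances of `sum_weight_energy_le`, for a law of the mode under which the links
in a row of the Laplacian are uncorrelated with symmetric success probabilities `π`. For such a law
the mean energy is the energy of the mean plus the variances
`π i j * (1 - π i j) * ‖Fᶜ (x i - x j)‖²` of the links, where the norm is that of the weight
`H = diag(Y, I)` (`sum_weight_rowSignal`). The factorization
`L⁰ = D Dᵀ` of the nominal Laplacian with its incidence matrix writes both parts with the link
signals `v = (Dᵀ ⊗ Fᶜ) x` and their multiples `π v`, `√(π (1 - π)) v` and `√π v`, which are the
responses of the uncertainties of the links with `a = √π`, `b = √(1 - π)`. In the coordinates given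
by the singular value decomposition of `D`, the estimate is the sum of the modal inequalities
(`sum_mean_add_variance_le`). The multiplier form has a sign only link by link, and the singular
vectors do not span the space of link signals. The remainder of the signals outside of their span
(`sum_bilin_eq_sum_proj_add_sum_rem`) has no component from `v` itself, so that a modal inequality
with vanishing state shows that the multiplier form is small enough there.
-/

/-! ### Bilinear forms -/

section BilinearForms

variable {M : Type*} [AddCommGroup M] [Module ℝ M]

/-- Pythagoras for an arbitrary bilinear form, applied fibrewise: `V` has orthogonal columns, each
of norm one or zero (`χ m` is the squared norm of the column `m`). -/
theorem sum_bilin_eq_sum_proj_add_sum_rem {E I : Type*} [Fintype E] [Fintype I] [DecidableEq I]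
    (b : LinearMap.BilinForm ℝ M) (V : E → I → ℝ) (χ : I → ℝ)
    (hV : ∀ m m', ∑ e, V e m * V e m' = if m = m' then χ m else 0)
    (hχ : ∀ m e, χ m * V e m = V e m) (ζ : E → M) :
    ∑ e, b (ζ e) (ζ e) =
      ∑ m, b (∑ e, V e m • ζ e) (∑ e, V e m • ζ e) +
      ∑ e, b (ζ e - ∑ m, V e m • ∑ e', V e' m • ζ e')
        (ζ e - ∑ m, V e m • ∑ e', V e' m • ζ e') := by
  set h : I → M := fun m => ∑ e, V e m • ζ e with hh
  have hχh : ∀ m, χ m • h m = h m := by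
    intro m
    simp only [hh, Finset.smul_sum, smul_smul, hχ]
  have h1 : ∑ e, b (ζ e) (∑ m, V e m • h m) = ∑ m, b (h m) (h m) := by
    simp only [map_sum, map_smul, smul_eq_mul]
    rw [Finset.sum_comm]
    refine Finset.sum_congr rfl fun m _ => ?_
    have : b (h m) (h m) = b (∑ e, V e m • ζ e) (h m) := rfl
    rw [this]
    simp only [map_sum, map_smul, LinearMap.sum_apply, LinearMap.smul_apply, smul_eq_mul]
  have h2 : ∑ e, b (∑ m, V e m • h m) (ζ e) = ∑ m, b (h m) (h m) := by
    simp only [map_sum, map_smul, LinearMap.sum_apply, LinearMap.smul_apply, smul_eq_mul]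
    rw [Finset.sum_comm]
    refine Finset.sum_congr rfl fun m _ => ?_
    have : b (h m) (h m) = b (h m) (∑ e, V e m • ζ e) := rfl
    rw [this]
    simp only [map_sum, map_smul, smul_eq_mul]
  have h3 : ∑ e, b (∑ m, V e m • h m) (∑ m, V e m • h m) = ∑ m, b (h m) (h m) := by
    simp only [map_sum, map_smul, LinearMap.sum_apply, LinearMap.smul_apply, smul_eq_mul,
      Finset.mul_sum]
    rw [Finset.sum_comm]
    refine Finset.sum_congr rfl fun m _ => ?_
    rw [Finset.sum_comm]
    have h4 : ∀ m', ∑ e, V e m * (V e m' * b (h m') (h m)) =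
        if m = m' then χ m * b (h m') (h m) else 0 := by
      intro m'
      rw [← ite_zero_mul, ← hV m m', Finset.sum_mul]
      exact Finset.sum_congr rfl fun e _ => by ring
    have h5 : χ m * b (h m) (h m) = b (h m) (h m) := by
      have h6 := congrArg (fun y => b y (h m)) (hχh m)
      simpa only [map_smul, LinearMap.smul_apply, smul_eq_mul] using h6
    simp only [h4, Finset.sum_ite_eq, Finset.mem_univ, if_true]
    exact h5
  simp only [map_sub, LinearMap.sub_apply, Finset.sum_sub_distrib]
  rw [h1, h2, h3]
  ring

/-- Bias-variance decomposition of a quadratic form for a combination of uncorrelated indicator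
variables `θ j` with means `π j`, on a finite probability space with weights `ν`. -/
theorem sum_weight_bilin_eq {K J : Type*} [Fintype K] [Fintype J] [DecidableEq J]
    (b : LinearMap.BilinForm ℝ M) (ν : K → ℝ) (hν : ∑ k, ν k = 1)
    (θ : J → K → ℝ) (π : J → ℝ) (hθ : ∀ j, ∑ k, ν k * θ j k = π j)
    (hθ2 : ∀ j k, θ j k * θ j k = θ j k)
    (hcov : ∀ j l, j ≠ l → ∑ k, ν k * (θ j k * θ l k) = π j * π l)
    (c : M) (v : J → M) :
    ∑ k, ν k * b (c + ∑ j, θ j k • v j) (c + ∑ j, θ j k • v j) =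
      b (c + ∑ j, π j • v j) (c + ∑ j, π j • v j) + ∑ j, π j * (1 - π j) * b (v j) (v j) := by
  have hmom : ∀ j l, ∑ k, ν k * (θ j k * θ l k) =
      π j * π l + if j = l then π j * (1 - π j) else 0 := by
    intro j l
    split_ifs with h
    · subst h
      simp only [hθ2, hθ]
      ring
    · rw [hcov j l h, add_zero]
  have expand : ∀ τ : J → ℝ, b (c + ∑ j, τ j • v j) (c + ∑ j, τ j • v j) =
      b c c + ∑ j, τ j * (b c (v j) + b (v j) c) +
        ∑ j, ∑ l, τ j * τ l * b (v j) (v l) := by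
    intro τ
    simp only [map_add, map_sum, map_smul, LinearMap.add_apply, LinearMap.sum_apply,
      LinearMap.smul_apply, smul_eq_mul, mul_add, Finset.sum_add_distrib, Finset.mul_sum]
    have : ∑ x, ∑ y, τ x * (τ y * b (v y) (v x)) = ∑ j, ∑ l, τ j * τ l * b (v j) (v l) := by
      rw [Finset.sum_comm]
      exact Finset.sum_congr rfl fun _ _ => Finset.sum_congr rfl fun _ _ => by ring
    rw [this]
    ring
  simp only [expand, mul_add, Finset.sum_add_distrib, Finset.mul_sum]
  have e1 : ∑ k, ν k * b c c = b c c := by rw [← Finset.sum_mul, hν, one_mul]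
  have e2 : ∀ f : J → ℝ, ∑ k, ∑ j, ν k * (θ j k * f j) = ∑ j, π j * f j := by
    intro f
    rw [Finset.sum_comm]
    refine Finset.sum_congr rfl fun j _ => ?_
    rw [← hθ j, Finset.sum_mul]
    exact Finset.sum_congr rfl fun k _ => by ring
  have e3 : ∑ k, ∑ j, ∑ l, ν k * (θ j k * θ l k * b (v j) (v l)) =
      ∑ j, ∑ l, π j * π l * b (v j) (v l) + ∑ j, π j * (1 - π j) * b (v j) (v j) := by
    rw [Finset.sum_comm, ← Finset.sum_add_distrib]
    refine Finset.sum_congr rfl fun j _ => ?_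
    rw [Finset.sum_comm]
    have : ∀ l, ∑ k, ν k * (θ j k * θ l k * b (v j) (v l)) =
        π j * π l * b (v j) (v l) + if j = l then π j * (1 - π j) * b (v j) (v l) else 0 := by
      intro l
      rw [← ite_zero_mul, ← add_mul, ← hmom j l, Finset.sum_mul]
      exact Finset.sum_congr rfl fun k _ => by ring
    simp only [this, Finset.sum_add_distrib, Finset.sum_ite_eq, Finset.mem_univ, if_true]
  rw [e1, e2, e2, e3]
  ring

end BilinearForms

theorem real_dotProduct_self_nonneg {ι : Type*} [Fintype ι] (x : ι → ℝ) : 0 ≤ x ⬝ᵥ x :=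
  Finset.sum_nonneg fun _ _ => mul_self_nonneg _

/-- A continuous function that is homogeneous of degree two and positive away from the origin
dominates a positive multiple of the squared Euclidean norm. -/
theorem exists_pos_mul_dotProduct_le {ι : Type*} [Fintype ι] (g : (ι → ℝ) → ℝ)
    (hg : Continuous g) (hhom : ∀ (c : ℝ) x, g (c • x) = c ^ 2 * g x)
    (hpos : ∀ x, x ≠ 0 → 0 < g x) : ∃ ε > 0, ∀ x, ε * (x ⬝ᵥ x) ≤ g x := by
  have h0 : g 0 = 0 := by simpa using hhom 0 0
  have hdot : Continuous fun x : ι → ℝ => x ⬝ᵥ x := by unfold dotProduct; fun_prop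
  rcases (Metric.sphere (0 : ι → ℝ) 1).eq_empty_or_nonempty with he | hne
  · refine ⟨1, one_pos, fun x => ?_⟩
    by_cases hx : x = 0
    · simp [hx, h0]
    · have : (‖x‖⁻¹ • x) ∈ Metric.sphere (0 : ι → ℝ) 1 := by
        simp [norm_smul, inv_mul_cancel₀ (norm_ne_zero_iff.mpr hx)]
      simp [he] at this
  · have hd : ∀ x : ι → ℝ, x ≠ 0 → 0 < x ⬝ᵥ x := fun x hx =>
      lt_of_le_of_ne (Finset.sum_nonneg fun i _ => mul_self_nonneg _)
        (Ne.symm (fun h => hx (dotProduct_self_eq_zero.mp h)))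
    have hne0 : ∀ x ∈ Metric.sphere (0 : ι → ℝ) 1, x ≠ 0 := by
      rintro x hx rfl
      simp at hx
    obtain ⟨x₀, hx₀, hmin⟩ := (isCompact_sphere (0 : ι → ℝ) 1).exists_isMinOn hne
      (f := fun x => g x / (x ⬝ᵥ x))
      (hg.continuousOn.div hdot.continuousOn fun x hx => (hd x (hne0 x hx)).ne')
    refine ⟨g x₀ / (x₀ ⬝ᵥ x₀), div_pos (hpos _ (hne0 _ hx₀)) (hd _ (hne0 _ hx₀)), fun x => ?_⟩
    by_cases hx : x = 0
    · simp [hx, h0]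
    have hn : ‖x‖ ≠ 0 := norm_ne_zero_iff.mpr hx
    have hmem : (‖x‖⁻¹ • x) ∈ Metric.sphere (0 : ι → ℝ) 1 := by
      simp [norm_smul, inv_mul_cancel₀ hn]
    have := hmin hmem
    simp only [Set.mem_ofPred_eq] at this
    rw [le_div_iff₀ (hd _ (hne0 _ hmem)), hhom, smul_dotProduct, dotProduct_smul] at this
    simp only [smul_eq_mul] at this
    have hp : 0 < ‖x‖⁻¹ ^ 2 := by positivity
    refine le_of_mul_le_mul_left ?_ hp
    linarith

/-! ### Markov chains and Lyapunov functions -/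

section MarkovChains

theorem integral_comp_finite {Ω S : Type*} [MeasurableSpace Ω] (Q : Measure Ω) [IsFiniteMeasure Q]
    [Fintype S] [MeasurableSpace S] [MeasurableSingletonClass S] {f : Ω → S} (hf : Measurable f)
    (g : S → ℝ) : ∫ ω, g (f ω) ∂Q = ∑ s, Q.real {ω | f ω = s} * g s := by
  have hm : AEStronglyMeasurable g (Q.map f) :=
    (measurable_of_finite g).aestronglyMeasurable
  rw [← integral_map hf.aemeasurable hm, integral_fintype Integrable.of_finite]
  refine Finset.sum_congr rfl fun s _ => ?_
  rw [map_measureReal_apply hf (measurableSet_singleton s), smul_eq_mul]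
  rfl

variable {K Ω : Type*} [MeasurableSpace Ω] {t : K → K → ℝ} {P : K → Measure Ω}
  {σ : ℕ → Ω → K}

/-- The mode sequence whose first `k + 1` members are given by `c`, continued constantly. -/
def extendModes {k : ℕ} (c : Fin (k + 1) → K) (l : ℕ) : K :=
  c ⟨min l k, Nat.lt_succ_of_le (min_le_right l k)⟩

/-- A function of the modes up to time `k` is a function on the finite set of paths of length
`k + 1`. -/
theorem DependsOn.eq_extendModes {β : Type*} {k : ℕ} {F : (ℕ → K) → β}
    (hF : DependsOn F (Set.Iic k)) (s : ℕ → K) :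
    F s = F (extendModes fun l : Fin (k + 1) => s l) :=
  hF fun l hl => by simp [extendModes, Set.mem_Iic.mp hl]

namespace IsMarkovFamily

theorem measurable_mode [Countable K] [MeasurableSpace K] [MeasurableSingletonClass K]
    (hσ : IsMarkovFamily t P σ) (k : ℕ) : Measurable (σ k) :=
  measurable_to_countable' fun j => hσ.meas k j

theorem integrable [Finite K] (hσ : IsMarkovFamily t P σ) (i : K) {k : ℕ} {F : (ℕ → K) → ℝ}
    (hF : DependsOn F (Set.Iic k)) : Integrable (fun ω => F fun l => σ l ω) (P i) := by
  let _ : MeasurableSpace K := ⊤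
  have := hσ.prob i
  have hR : Measurable fun ω (l : Fin (k + 1)) => σ l ω :=
    measurable_pi_lambda _ fun l => hσ.measurable_mode l
  have : (fun ω => F fun l => σ l ω) =
      (fun c : Fin (k + 1) → K => F (extendModes c)) ∘ fun ω (l : Fin (k + 1)) => σ l ω := by
    funext ω
    exact hF.eq_extendModes _
  rw [this]
  exact (Integrable.of_finite (μ := (P i).map _)).comp_measurable hR

/-- The Markov property for functions of the past and the next mode. -/
theorem integral_next [Fintype K] (hσ : IsMarkovFamily t P σ) (i : K) {k : ℕ} {F : (ℕ → K) → K → ℝ}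
    (hF : DependsOn F (Set.Iic k)) :
    ∫ ω, F (fun l => σ l ω) (σ (k + 1) ω) ∂(P i) =
      ∫ ω, ∑ j, t (σ k ω) j * F (fun l => σ l ω) j ∂(P i) := by
  let _ : MeasurableSpace K := ⊤
  have := hσ.prob i
  have hR : Measurable fun ω (l : Fin (k + 1)) => σ l ω :=
    measurable_pi_lambda _ fun l => hσ.measurable_mode l
  have hRS : Measurable fun ω => ((fun l : Fin (k + 1) => σ l ω), σ (k + 1) ω) :=
    hR.prodMk (hσ.measurable_mode _)
  have hpath : ∀ ω, F (fun l => σ l ω) = F (extendModes fun l : Fin (k + 1) => σ l ω) :=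
    fun ω => hF.eq_extendModes _
  have hlast : ∀ ω, σ k ω = (fun l : Fin (k + 1) => σ l ω) (Fin.last k) := fun ω => rfl
  have hmarkov : ∀ (c : Fin (k + 1) → K) (j : K),
      (P i).real {ω | ((fun l : Fin (k + 1) => σ l ω), σ (k + 1) ω) = (c, j)} =
        (P i).real {ω | (fun l : Fin (k + 1) => σ l ω) = c} * t (c (Fin.last k)) j := by
    intro c j
    have h := hσ.markov i k fun l => if l ≤ k then extendModes c l else j
    have e1 : {ω | ∀ l ≤ k + 1, σ l ω = if l ≤ k then extendModes c l else j} =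
        {ω | ((fun l : Fin (k + 1) => σ l ω), σ (k + 1) ω) = (c, j)} := by
      ext ω
      constructor
      · intro hω
        refine Prod.ext (funext fun l => ?_) ?_
        · have hl : (l : ℕ) ≤ k := Nat.lt_succ_iff.mp l.2
          have := hω l (by omega)
          simpa [hl, extendModes] using this
        · simpa using hω (k + 1) le_rfl
      · intro hω l hl
        obtain ⟨h1, h2⟩ := Prod.ext_iff.mp hω
        by_cases hlk : l ≤ k
        · have := congrFun h1 ⟨l, Nat.lt_succ_of_le hlk⟩
          simpa [hlk, extendModes] using this
        · obtain rfl : l = k + 1 := by omega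
          simpa using h2
    have e2 : {ω | ∀ l ≤ k, σ l ω = if l ≤ k then extendModes c l else j} =
        {ω | (fun l : Fin (k + 1) => σ l ω) = c} := by
      ext ω
      constructor
      · intro hω
        refine funext fun l => ?_
        have hl : (l : ℕ) ≤ k := Nat.lt_succ_iff.mp l.2
        simpa [hl, extendModes] using hω l hl
      · intro hω l hl
        have := congrFun hω ⟨l, Nat.lt_succ_of_le hl⟩
        simpa [hl, extendModes] using this
    rw [e1, e2] at h
    rw [h]
    simp [extendModes, Fin.last]
  have h1 := integral_comp_finite (P i) hRS
    fun cj : (Fin (k + 1) → K) × K => F (extendModes cj.1) cj.2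
  have h2 := integral_comp_finite (P i) hR
    fun c : Fin (k + 1) → K => ∑ j, t (c (Fin.last k)) j * F (extendModes c) j
  simp only [hpath, hlast]
  refine h1.trans (Eq.trans ?_ h2.symm)
  rw [Fintype.sum_prod_type]
  refine Finset.sum_congr rfl fun c _ => ?_
  rw [Finset.mul_sum]
  refine Finset.sum_congr rfl fun j _ => ?_
  rw [hmarkov]
  ring

theorem ae_start (hσ : IsMarkovFamily t P σ) (i : K) : ∀ᵐ ω ∂(P i), σ 0 ω = i := by
  have := hσ.prob i
  exact (prob_compl_eq_zero_iff (hσ.meas 0 i)).mpr (hσ.start i)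

theorem integral_start (hσ : IsMarkovFamily t P σ) (i : K) (f : K → ℝ) :
    ∫ ω, f (σ 0 ω) ∂(P i) = f i := by
  have := hσ.prob i
  have : (fun ω => f (σ 0 ω)) =ᵐ[P i] fun _ => f i := by
    filter_upwards [hσ.ae_start i] with ω hω
    rw [hω]
  rw [integral_congr_ae this]
  simp

/-- The law of the mode at time one. -/
theorem integral_one [Fintype K] (hσ : IsMarkovFamily t P σ) (i : K) (f : K → ℝ) :
    ∫ ω, f (σ 1 ω) ∂(P i) = ∑ j, t i j * f j := by
  have h := hσ.integral_next i (k := 0) (F := fun _ j => f j) (fun _ _ _ => rfl)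
  simp only [zero_add] at h
  rw [h]
  exact hσ.integral_start i fun e => ∑ j, t e j * f j

end IsMarkovFamily

end MarkovChains

namespace MJLS

variable {K X W Z : Type*} [Fintype K] [Fintype X] [Fintype W]
  {Ω : Type*} [MeasurableSpace Ω] {P : K → Measure Ω} {σ : ℕ → Ω → K}

theorem dependsOn_state (G : MJLS K X W Z) (x₀ : X → ℝ) (w : ℕ → W → ℝ) (k : ℕ) :
    DependsOn (fun s : ℕ → K => G.state s x₀ w k) (Set.Iio k) := by
  induction k with
  | zero => exact fun _ _ _ => rfl
  | succ k ih =>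
    intro s s' h
    have h1 := ih fun l hl => h l (Set.mem_Iio.mpr (Nat.lt_succ_of_lt hl))
    have h2 : s k = s' k := h k (Set.mem_Iio.mpr (Nat.lt_succ_self k))
    simp only at h1
    simp only [state, h1, h2]

theorem dependsOn_state_succ (G : MJLS K X W Z) (x₀ : X → ℝ) (w : ℕ → W → ℝ) (k : ℕ) :
    DependsOn (fun s : ℕ → K => G.state s x₀ w (k + 1)) (Set.Iic k) := by
  have := G.dependsOn_state x₀ w (k + 1)
  rwa [show Set.Iio (k + 1) = Set.Iic k from by ext; simp] at this

theorem dependsOn_output (G : MJLS K X W Z) (x₀ : X → ℝ) (w : ℕ → W → ℝ) (k : ℕ) :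
    DependsOn (fun s : ℕ → K => G.output s x₀ w k) (Set.Iic k) := by
  intro s s' h
  have h1 := G.dependsOn_state x₀ w k fun l hl => h l (Set.mem_Iic.mpr (Set.mem_Iio.mp hl).le)
  have h2 : s k = s' k := h k (Set.mem_Iic.mpr le_rfl)
  simp only at h1
  simp only [output, h1, h2]

variable [Fintype Z]

/-- If `V` decreases in conditional mean by the output energy and a multiple of the squared norm
of the state, then the energy of the state and the output from time one on is at most the mean of
`V` at time one. The input is zero from time one on. -/
theorem sum_energy_le (G : MJLS K X W Z) (hσ : IsMarkovFamily G.t P σ) (V : (X → ℝ) → ℝ)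
    (hV : ∀ x, 0 ≤ V x) (ε : ℝ)
    (hdec : ∀ E x, ∑ j, G.t E j * (V (G.A j *ᵥ x) + (G.C j *ᵥ x) ⬝ᵥ (G.C j *ᵥ x)) +
      ε * (x ⬝ᵥ x) ≤ V x)
    (x₀ : X → ℝ) (w : ℕ → W → ℝ) (hw : ∀ k, w (k + 1) = 0) (i : K) (n : ℕ) :
    ∑ k ∈ Finset.range n,
      (∫ ω, G.output (fun l => σ l ω) x₀ w (k + 1) ⬝ᵥ G.output (fun l => σ l ω) x₀ w (k + 1) ∂(P i)
        + ε * ∫ ω, G.state (fun l => σ l ω) x₀ w (k + 1) ⬝ᵥ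
          G.state (fun l => σ l ω) x₀ w (k + 1) ∂(P i)) ≤
      V (G.A i *ᵥ x₀ + G.B i *ᵥ w 0) := by
  set x : ℕ → Ω → X → ℝ := fun k ω => G.state (fun l => σ l ω) x₀ w k with hx
  set z : ℕ → Ω → Z → ℝ := fun k ω => G.output (fun l => σ l ω) x₀ w k with hz
  have hxi : ∀ (g : (X → ℝ) → ℝ) k, Integrable (fun ω => g (x (k + 1) ω)) (P i) := fun g k =>
    hσ.integrable i (k := k) (F := fun s => g (G.state s x₀ w (k + 1))) fun s s' h =>
      congrArg g (G.dependsOn_state_succ x₀ w k h)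
  have hzi : ∀ k, Integrable (fun ω => z k ω ⬝ᵥ z k ω) (P i) := fun k =>
    hσ.integrable i (k := k) (F := fun s => G.output s x₀ w k ⬝ᵥ G.output s x₀ w k) fun s s' h =>
      congrArg (fun y => y ⬝ᵥ y) (G.dependsOn_output x₀ w k h)
  have hstep : ∀ k, ∫ ω, V (x (k + 2) ω) ∂(P i) + (∫ ω, z (k + 1) ω ⬝ᵥ z (k + 1) ω ∂(P i) +
      ε * ∫ ω, x (k + 1) ω ⬝ᵥ x (k + 1) ω ∂(P i)) ≤ ∫ ω, V (x (k + 1) ω) ∂(P i) := by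
    intro k
    have hnext := hσ.integral_next i (k := k)
      (F := fun s j => V (G.A j *ᵥ G.state s x₀ w (k + 1)) +
        (G.C j *ᵥ G.state s x₀ w (k + 1)) ⬝ᵥ (G.C j *ᵥ G.state s x₀ w (k + 1)))
      (fun s s' h => congrArg (fun y j => V (G.A j *ᵥ y) + (G.C j *ᵥ y) ⬝ᵥ (G.C j *ᵥ y))
        (G.dependsOn_state_succ x₀ w k h))
    have e1 : ∀ ω, x (k + 2) ω = G.A (σ (k + 1) ω) *ᵥ x (k + 1) ω := by
      intro ω
      change G.A (σ (k + 1) ω) *ᵥ x (k + 1) ω + G.B (σ (k + 1) ω) *ᵥ w (k + 1) = _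
      rw [hw, Matrix.mulVec_zero, add_zero]
    have e2 : ∀ ω, z (k + 1) ω = G.C (σ (k + 1) ω) *ᵥ x (k + 1) ω := by
      intro ω
      change G.C (σ (k + 1) ω) *ᵥ x (k + 1) ω + G.D (σ (k + 1) ω) *ᵥ w (k + 1) = _
      rw [hw, Matrix.mulVec_zero, add_zero]
    have hint2 : Integrable (fun ω => ∑ j, G.t (σ k ω) j * (V (G.A j *ᵥ x (k + 1) ω) +
        (G.C j *ᵥ x (k + 1) ω) ⬝ᵥ (G.C j *ᵥ x (k + 1) ω))) (P i) :=
      hσ.integrable i (k := k) (F := fun s => ∑ j, G.t (s k) j *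
        (V (G.A j *ᵥ G.state s x₀ w (k + 1)) +
        (G.C j *ᵥ G.state s x₀ w (k + 1)) ⬝ᵥ (G.C j *ᵥ G.state s x₀ w (k + 1)))) (by
          intro s s' h
          have h1 := G.dependsOn_state_succ x₀ w k h
          have h2 : s k = s' k := h k (Set.mem_Iic.mpr le_rfl)
          simp only at h1
          simp only [h1, h2])
    rw [← add_assoc, ← integral_add (hxi V (k + 1)) (hzi (k + 1))]
    have e3 : ∫ ω, V (x (k + 2) ω) + z (k + 1) ω ⬝ᵥ z (k + 1) ω ∂(P i) =
        ∫ ω, ∑ j, G.t (σ k ω) j * (V (G.A j *ᵥ x (k + 1) ω) +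
        (G.C j *ᵥ x (k + 1) ω) ⬝ᵥ (G.C j *ᵥ x (k + 1) ω)) ∂(P i) := by
      simp only [e1, e2]
      exact hnext
    rw [show k + 1 + 1 = k + 2 from rfl, e3, ← integral_const_mul,
      ← integral_add hint2 ((hxi (fun y => y ⬝ᵥ y) k).const_mul ε)]
    exact integral_mono (hint2.add ((hxi (fun y => y ⬝ᵥ y) k).const_mul ε)) (hxi V k)
      fun ω => hdec (σ k ω) (x (k + 1) ω)
  have hfirst : ∫ ω, V (x 1 ω) ∂(P i) = V (G.A i *ᵥ x₀ + G.B i *ᵥ w 0) :=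
    hσ.integral_start i fun j => V (G.A j *ᵥ x₀ + G.B j *ᵥ w 0)
  have htel : ∀ n, ∫ ω, V (x (n + 1) ω) ∂(P i) + ∑ k ∈ Finset.range n,
      (∫ ω, z (k + 1) ω ⬝ᵥ z (k + 1) ω ∂(P i) +
        ε * ∫ ω, x (k + 1) ω ⬝ᵥ x (k + 1) ω ∂(P i)) ≤ V (G.A i *ᵥ x₀ + G.B i *ᵥ w 0) := by
    intro n
    induction n with
    | zero => simp [hfirst]
    | succ n ih =>
      rw [Finset.sum_range_succ]
      have := hstep n
      linarith
  have h0 : 0 ≤ ∫ ω, V (x (n + 1) ω) ∂(P i) := integral_nonneg fun ω => hV _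
  linarith [htel n]

/-- The energy bound makes `E‖x k‖²` summable, so that it tends to zero. -/
theorem isMeanSquareStable_of_lyapunov [DecidableEq X] (G : MJLS K X W Z)
    (hσ : IsMarkovFamily G.t P σ) (V : (X → ℝ) → ℝ) (hV : ∀ x, 0 ≤ V x) {ε : ℝ} (hε : 0 < ε)
    (hdec : ∀ E x, ∑ j, G.t E j * (V (G.A j *ᵥ x) + (G.C j *ᵥ x) ⬝ᵥ (G.C j *ᵥ x)) +
      ε * (x ⬝ᵥ x) ≤ V x) : G.IsMeanSquareStable P σ := by
  intro x₀ i
  have := hσ.prob i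
  set x : ℕ → Ω → X → ℝ := fun k ω => G.state (fun l => σ l ω) x₀ 0 k with hx
  set m : ℕ → ℝ := fun k => ∫ ω, x k ω ⬝ᵥ x k ω ∂(P i) with hm
  have hm0 : ∀ k, 0 ≤ m k := fun k => integral_nonneg fun ω => real_dotProduct_self_nonneg _
  have hsum : Summable fun k => m (k + 1) := by
    refine summable_of_sum_range_le (c := V (G.A i *ᵥ x₀ + G.B i *ᵥ (0 : W → ℝ)) / ε)
      (fun k => hm0 _) fun n => ?_
    have h := G.sum_energy_le hσ V hV ε hdec x₀ 0 (fun _ => rfl) i n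
    rw [le_div_iff₀ hε, Finset.sum_mul]
    refine le_trans (Finset.sum_le_sum fun k _ => ?_) h
    have : 0 ≤ ∫ ω, G.output (fun l => σ l ω) x₀ 0 (k + 1) ⬝ᵥ
        G.output (fun l => σ l ω) x₀ 0 (k + 1) ∂(P i) :=
      integral_nonneg fun ω => real_dotProduct_self_nonneg _
    simp only [hm, hx]
    linarith
  have hlim : Filter.Tendsto m Filter.atTop (nhds 0) :=
    (Filter.tendsto_add_atTop_iff_nat 1).mp hsum.tendsto_atTop_zero
  have hxi : ∀ (g : (X → ℝ) → ℝ) k, Integrable (fun ω => g (x k ω)) (P i) := fun g k =>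
    hσ.integrable i (k := k) (F := fun s => g (G.state s x₀ 0 k)) fun s s' h =>
      congrArg g (G.dependsOn_state x₀ 0 k fun l hl => h l (Set.mem_Iic.mpr (Set.mem_Iio.mp hl).le))
  have hnorm : ∀ y : X → ℝ, ‖WithLp.toLp 2 y‖ ^ 2 = y ⬝ᵥ y := by
    intro y
    rw [EuclideanSpace.real_norm_sq_eq]
    exact Finset.sum_congr rfl fun _ _ => pow_two _
  constructor
  · -- Jensen's inequality `(E‖x‖)² ≤ E‖x‖²`, as nonnegativity of the variance.
    have hjensen : ∀ k, (∫ ω, ‖WithLp.toLp 2 (x k ω)‖ ∂(P i)) ^ 2 ≤ m k := by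
      intro k
      set a := ∫ ω, ‖WithLp.toLp 2 (x k ω)‖ ∂(P i) with ha
      have h0 : 0 ≤ ∫ ω, (‖WithLp.toLp 2 (x k ω)‖ - a) ^ 2 ∂(P i) :=
        integral_nonneg fun ω => sq_nonneg _
      have e : ∀ ω, (‖WithLp.toLp 2 (x k ω)‖ - a) ^ 2 =
          x k ω ⬝ᵥ x k ω - 2 * a * ‖WithLp.toLp 2 (x k ω)‖ + a ^ 2 := by
        intro ω
        rw [← hnorm]
        ring
      have i1 := hxi (fun y => y ⬝ᵥ y) k
      have i2 := (hxi (fun y => ‖WithLp.toLp 2 y‖) k).const_mul (2 * a)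
      simp only [e] at h0
      have e2 : ∫ ω, (x k ω ⬝ᵥ x k ω - 2 * a * ‖WithLp.toLp 2 (x k ω)‖ + a ^ 2) ∂(P i) =
          m k - 2 * a * a + a ^ 2 := by
        rw [integral_add (f := fun ω => x k ω ⬝ᵥ x k ω - 2 * a * ‖WithLp.toLp 2 (x k ω)‖)
          (g := fun _ => a ^ 2) (i1.sub i2) (integrable_const _), integral_sub i1 i2,
          integral_const_mul]
        simp [hm, ha]
      rw [e2] at h0
      linarith
    refine squeeze_zero (fun k => integral_nonneg fun ω => norm_nonneg _)
      (fun k => Real.le_sqrt_of_sq_le (hjensen k)) ?_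
    simpa using hlim.sqrt
  · refine squeeze_zero (fun k => integral_nonneg fun ω => norm_nonneg _) (fun k => ?_) hlim
    refine integral_mono (hxi (fun y => ‖Matrix.toEuclideanCLM (n := X) (𝕜 := ℝ)
      (Matrix.vecMulVec y y)‖) k) (hxi (fun y => y ⬝ᵥ y) k) fun ω => ?_
    refine ContinuousLinearMap.opNorm_le_bound _ (real_dotProduct_self_nonneg _) fun v => ?_
    have hv : Matrix.toEuclideanCLM (n := X) (𝕜 := ℝ) (Matrix.vecMulVec (x k ω) (x k ω)) v =
        (inner ℝ (WithLp.toLp 2 (x k ω)) v) • WithLp.toLp 2 (x k ω) := by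
      ext a
      simp [Matrix.vecMulVec_mulVec, EuclideanSpace.inner_eq_star_dotProduct, dotProduct_comm,
        mul_comm]
    change ‖Matrix.toEuclideanCLM (n := X) (𝕜 := ℝ) (Matrix.vecMulVec (x k ω) (x k ω)) v‖ ≤
      (x k ω ⬝ᵥ x k ω) * ‖v‖
    rw [hv, norm_smul, ← hnorm]
    calc ‖inner ℝ (WithLp.toLp 2 (x k ω)) v‖ * ‖WithLp.toLp 2 (x k ω)‖
        ≤ (‖WithLp.toLp 2 (x k ω)‖ * ‖v‖) * ‖WithLp.toLp 2 (x k ω)‖ := by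
          gcongr
          exact norm_inner_le_norm _ _
      _ = _ := by ring

/-- The energy of an impulse response: the energy of the output at time zero, and the value of the
Lyapunov function at time one as a bound for everything later. -/
theorem impulseEnergy_le [DecidableEq W] (G : MJLS K X W Z)
    (hσ : IsMarkovFamily G.t P σ) (V : (X → ℝ) → ℝ) (hV : ∀ x, 0 ≤ V x) {ε : ℝ} (hε : 0 ≤ ε)
    (hdec : ∀ E x, ∑ j, G.t E j * (V (G.A j *ᵥ x) + (G.C j *ᵥ x) ⬝ᵥ (G.C j *ᵥ x)) +
      ε * (x ⬝ᵥ x) ≤ V x) (s : W) (i : K) :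
    G.impulseEnergy P σ s i ≤ ENNReal.ofReal (V (G.B i *ᵥ Pi.single s 1) +
      (G.D i *ᵥ Pi.single s 1) ⬝ᵥ (G.D i *ᵥ Pi.single s 1)) := by
  set z : ℕ → Ω → Z → ℝ := fun k ω => G.output (fun l => σ l ω) 0 (impulse s) k with hz
  have hzi : ∀ k, Integrable (fun ω => z k ω ⬝ᵥ z k ω) (P i) := fun k =>
    hσ.integrable i (k := k) (F := fun r => G.output r 0 (impulse s) k ⬝ᵥ
      G.output r 0 (impulse s) k) fun r r' h =>
      congrArg (fun y => y ⬝ᵥ y) (G.dependsOn_output 0 (impulse s) k h)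
  have hlint : ∀ k, ∫⁻ ω, ENNReal.ofReal (z k ω ⬝ᵥ z k ω) ∂(P i) =
      ENNReal.ofReal (∫ ω, z k ω ⬝ᵥ z k ω ∂(P i)) := fun k =>
    (ofReal_integral_eq_lintegral_ofReal (hzi k)
      (Filter.Eventually.of_forall fun ω => real_dotProduct_self_nonneg _)).symm
  have hnn : ∀ k, 0 ≤ ∫ ω, z k ω ⬝ᵥ z k ω ∂(P i) := fun k =>
    integral_nonneg fun ω => real_dotProduct_self_nonneg _
  have hz0 : ∫ ω, z 0 ω ⬝ᵥ z 0 ω ∂(P i) =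
      (G.D i *ᵥ Pi.single s 1) ⬝ᵥ (G.D i *ᵥ Pi.single s 1) := by
    have h := hσ.integral_start i fun j =>
      (G.D j *ᵥ (Pi.single s 1 : W → ℝ)) ⬝ᵥ (G.D j *ᵥ Pi.single s 1)
    rw [← h]
    simp [hz, output, state, impulse]
  change ∑' k, ∫⁻ ω, ENNReal.ofReal (z k ω ⬝ᵥ z k ω) ∂(P i) ≤ _
  simp only [hlint]
  refine ENNReal.tsum_le_of_sum_range_le fun n => ?_
  rw [← ENNReal.ofReal_sum_of_nonneg fun k _ => hnn k]
  refine ENNReal.ofReal_le_ofReal ?_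
  have h := G.sum_energy_le hσ V hV ε hdec 0 (impulse s) (fun k => by simp [impulse]) i n
  have h' : ∑ k ∈ Finset.range n, ∫ ω, z (k + 1) ω ⬝ᵥ z (k + 1) ω ∂(P i) ≤
      V (G.B i *ᵥ Pi.single s 1) := by
    refine le_trans (Finset.sum_le_sum fun k _ => ?_) (le_trans h (le_of_eq ?_))
    · have : 0 ≤ ε * ∫ ω, G.state (fun l => σ l ω) 0 (impulse s) (k + 1) ⬝ᵥ
          G.state (fun l => σ l ω) 0 (impulse s) (k + 1) ∂(P i) :=
        mul_nonneg hε (integral_nonneg fun ω => real_dotProduct_self_nonneg _)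
      simp only [hz]
      linarith
    · simp [impulse]
  calc ∑ k ∈ Finset.range n, ∫ ω, z k ω ⬝ᵥ z k ω ∂(P i)
      ≤ ∑ k ∈ Finset.range (n + 1), ∫ ω, z k ω ⬝ᵥ z k ω ∂(P i) :=
        Finset.sum_le_sum_of_subset_of_nonneg (Finset.range_subset_range.mpr (Nat.le_succ n))
          fun k _ _ => hnn k
    _ = ∑ k ∈ Finset.range n, ∫ ω, z (k + 1) ω ⬝ᵥ z (k + 1) ω ∂(P i) +
          ∫ ω, z 0 ω ⬝ᵥ z 0 ω ∂(P i) := Finset.sum_range_succ' _ _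
    _ ≤ _ := by rw [hz0]; linarith

end MJLS

/-! ### Modal matrix inequalities -/

section SummationByParts

variable {I M : Type*} [Fintype I] [AddCommGroup M] [Module ℝ M]

theorem sum_sub_smul_eq_two_smul (f : I → ℝ) (g : I → I → M) (hg : ∀ i j, g j i = -g i j) :
    ∑ i, ∑ j, (f i - f j) • g i j = (2 : ℝ) • ∑ i, f i • ∑ j, g i j := by
  have h : ∑ i, ∑ j, f j • g i j = -∑ i, ∑ j, f i • g i j := by
    rw [Finset.sum_comm, ← Finset.sum_neg_distrib]
    refine Finset.sum_congr rfl fun i _ => ?_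
    rw [← Finset.sum_neg_distrib]
    exact Finset.sum_congr rfl fun j _ => by rw [hg i j, smul_neg]
  simp only [sub_smul, Finset.sum_sub_distrib, h, Finset.smul_sum, two_smul, sub_neg_eq_add,
    Finset.sum_add_distrib]

theorem sum_smul_sub_eq_two_smul (f : I → I → ℝ) (hf : ∀ i j, f j i = -f i j) (g : I → M) :
    ∑ i, ∑ j, f i j • (g i - g j) = (2 : ℝ) • ∑ i, (∑ j, f i j) • g i := by
  have h : ∑ i, ∑ j, f i j • g j = -∑ i, ∑ j, f i j • g i := by
    rw [Finset.sum_comm, ← Finset.sum_neg_distrib]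
    refine Finset.sum_congr rfl fun i _ => ?_
    rw [← Finset.sum_neg_distrib]
    exact Finset.sum_congr rfl fun j _ => by rw [hf i j, neg_smul]
  simp only [smul_sub, Finset.sum_sub_distrib, h, two_smul, sub_neg_eq_add, Finset.sum_smul]

end SummationByParts

section Modal

theorem stack_mulVec {ι κ : Type*} [Fintype κ] (M₁ M₂ : Matrix ι κ ℝ) (x : κ → ℝ) :
    stack M₁ M₂ *ᵥ x = fun r => ![(M₁ *ᵥ x) r.2, (M₂ *ᵥ x) r.2] r.1 := by
  ext ⟨r, a⟩
  fin_cases r <;> simp [stack, Matrix.mulVec, dotProduct]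

variable {ι v : Type*} [Fintype ι] [DecidableEq ι] [Fintype v] [DecidableEq v]

theorem dotProduct_transpose_mul_mul_mulVec {m n : Type*} [Fintype m] [Fintype n]
    (T : Matrix m n ℝ) (M : Matrix m m ℝ) (x : n → ℝ) :
    x ⬝ᵥ ((Tᵀ * M * T) *ᵥ x) = (T *ᵥ x) ⬝ᵥ (M *ᵥ (T *ᵥ x)) := by
  rw [← Matrix.mulVec_mulVec, ← Matrix.mulVec_mulVec, Matrix.dotProduct_mulVec,
    Matrix.vecMul_transpose]

theorem blockRow_mulVec (j : Fin 3) (w : Fin 3 × ι → ℝ) :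
    blockRow ι j *ᵥ w = fun a => w (j, a) := by
  ext a
  simp [blockRow, Matrix.mulVec, dotProduct, Matrix.one_apply]

/-- The quadratic form of the modal matrix, in terms of the state `x` and the signal `w`. -/
theorem dotProduct_modalMatrix (lam : ℝ) (S : Matrix v v ℝ) (H : Matrix ι ι ℝ)
    (Fd Fc Fp : Matrix ι v ℝ)
    (P : Matrix ((Fin 3 × ι) ⊕ (Fin 2 × ι)) ((Fin 3 × ι) ⊕ (Fin 2 × ι)) ℝ)
    (x : v → ℝ) (w : Fin 3 × ι → ℝ) :
    Sum.elim x w ⬝ᵥ (modalMatrix lam S H Fd Fc Fp P *ᵥ Sum.elim x w) =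
      -Matrix.toBilin' S x x +
      Matrix.toBilin' H ((Fd + lam • Fp) *ᵥ x + Real.sqrt lam • fun a => w (0, a))
        ((Fd + lam • Fp) *ᵥ x + Real.sqrt lam • fun a => w (0, a)) +
      2 * Matrix.toBilin' H (fun a => w (1, a)) (fun a => w (1, a)) +
      Matrix.toBilin' P
        (Sum.elim w fun r => ![w (2, r.2), Real.sqrt lam * (Fc *ᵥ x) r.2] r.1)
        (Sum.elim w fun r => ![w (2, r.2), Real.sqrt lam * (Fc *ᵥ x) r.2] r.1) := by
  have h1 : outerFactor lam Fd Fp *ᵥ Sum.elim x w =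
      Sum.elim x (Sum.elim ((Fd + lam • Fp) *ᵥ x + Real.sqrt lam • fun a => w (0, a))
        fun a => w (1, a)) := by
    rw [outerFactor, Matrix.fromBlocks_mulVec]
    congr 1
    · simp
    · ext (a | a) <;>
        simp [Matrix.fromRows_mulVec, Matrix.smul_mulVec, blockRow_mulVec]
  have h2 : multiplierFactor lam Fc *ᵥ Sum.elim x w =
      Sum.elim w fun r => ![w (2, r.2), Real.sqrt lam * (Fc *ᵥ x) r.2] r.1 := by
    rw [multiplierFactor, Matrix.fromBlocks_mulVec]
    congr 1
    · simp
    · ext ⟨r, a⟩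
      fin_cases r <;>
        simp [stack_mulVec, Matrix.smul_mulVec, blockRow_mulVec]
  rw [modalMatrix, Matrix.add_mulVec, dotProduct_add, dotProduct_transpose_mul_mul_mulVec,
    dotProduct_transpose_mul_mul_mulVec, h1, h2]
  simp only [Matrix.toBilin'_apply', centreMatrix, Matrix.fromBlocks_mulVec, Sum.elim_comp_inl,
    Sum.elim_comp_inr, Matrix.zero_mulVec, add_zero, zero_add, sumElim_dotProduct_sumElim,
    Matrix.neg_mulVec, dotProduct_neg, Matrix.smul_mulVec, dotProduct_smul, smul_eq_mul]
  ring

/-- The signal of a link with success probability `a ^ 2`: a multiplier is nonnegative on it. -/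
theorem toBilin'_nonneg_of_mem_multiplierSet {ρl ρu : ℝ}
    {P : Matrix ((Fin 3 × ι) ⊕ (Fin 2 × ι)) ((Fin 3 × ι) ⊕ (Fin 2 × ι)) ℝ}
    (hP : P ∈ multiplierSet ι ρl ρu) {a b : ℝ} (ha : 0 ≤ a) (hb : 0 ≤ b)
    (ha2 : a ^ 2 ∈ Set.Icc ρl ρu) (hb2 : b ^ 2 = 1 - a ^ 2) (y : ι → ℝ) :
    0 ≤ Matrix.toBilin' P
      (Sum.elim (fun r => ![a * a, b * a, a] r.1 * y r.2) fun r => ![a, 1] r.1 * y r.2)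
      (Sum.elim (fun r => ![a * a, b * a, a] r.1 * y r.2) fun r => ![a, 1] r.1 * y r.2) := by
  have h := (hP.2 !![a, 0; b, 0; 0, a] ⟨a, b, ha, hb, ha2, hb2, rfl⟩).posSemidef
  have h' := h.dotProduct_mulVec_nonneg (fun r => ![a, 1] r.1 * y r.2)
  rw [star_trivial, dotProduct_transpose_mul_mul_mulVec] at h'
  have e : uncertaintyFactor ι !![a, 0; b, 0; 0, a] *ᵥ (fun r => ![a, 1] r.1 * y r.2) =
      Sum.elim (fun r => ![a * a, b * a, a] r.1 * y r.2) fun r => ![a, 1] r.1 * y r.2 := by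
    rw [uncertaintyFactor, Matrix.fromRows_mulVec, Matrix.one_mulVec]
    congr 1
    ext ⟨k, c⟩
    simp only [Matrix.mulVec, dotProduct, Fintype.sum_prod_type, Matrix.kroneckerMap_apply,
      Matrix.one_apply, Fin.sum_univ_two]
    fin_cases k <;> simp [mul_assoc]
  rw [e] at h'
  rwa [Matrix.toBilin'_apply']

end Modal

section ModalBound

variable {ι v : Type*} [Fintype ι] [DecidableEq ι] [Fintype v] [DecidableEq v]

/-- The indicator function of the links. -/
noncomputable def edgeWeight {N : ℕ} (E : Finset (Fin N × Fin N)) (i j : Fin N) : ℝ :=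
  if (i, j) ∈ E then 1 else 0

/-- An orthonormal basis of eigenvectors `U · m` of the Laplacian of `E`, with eigenvalues
`lam m`. The eigenvalue equation is written with differences along the links. -/
structure IsModalBasis {N : ℕ} (E : Finset (Fin N × Fin N)) (lam : Fin N → ℝ)
    (U : Fin N → Fin N → ℝ) : Prop where
  col : ∀ m m', ∑ i, U i m * U i m' = if m = m' then 1 else 0
  row : ∀ i j, ∑ m, U i m * U j m = if i = j then 1 else 0
  eig : ∀ i m, ∑ j, edgeWeight E i j * (U i m - U j m) = lam m * U i m

theorem IsModalBasis.sum_smul_sum_smul {N : ℕ} {E : Finset (Fin N × Fin N)} {lam : Fin N → ℝ}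
    {U : Fin N → Fin N → ℝ} (hU : IsModalBasis E lam U) {M : Type*} [AddCommGroup M] [Module ℝ M]
    (y : Fin N → M) (i : Fin N) : ∑ m, U i m • ∑ i', U i' m • y i' = y i := by
  simp only [Finset.smul_sum, smul_smul]
  rw [Finset.sum_comm]
  simp only [← Finset.sum_smul, hU.row, ite_smul, one_smul, zero_smul, Finset.sum_ite_eq,
    Finset.mem_univ, if_true]

/-- Parseval's identity for an arbitrary bilinear form. -/
theorem IsModalBasis.sum_bilin_eq {N : ℕ} {E : Finset (Fin N × Fin N)} {lam : Fin N → ℝ}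
    {U : Fin N → Fin N → ℝ} (hU : IsModalBasis E lam U) {M : Type*} [AddCommGroup M] [Module ℝ M]
    (b : LinearMap.BilinForm ℝ M) (y : Fin N → M) :
    ∑ i, b (y i) (y i) = ∑ m, b (∑ i, U i m • y i) (∑ i, U i m • y i) := by
  rw [sum_bilin_eq_sum_proj_add_sum_rem b U (fun _ => 1) hU.col (fun _ _ => one_mul _) y,
    add_eq_left]
  refine Finset.sum_eq_zero fun i _ => ?_
  rw [hU.sum_smul_sum_smul, sub_self, map_zero]

/-- The signal of agent `i`, with the neighbours weighted by `τ` in the coupling through `Fc`. -/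
noncomputable def rowSignal {N : ℕ} (E₀ : Finset (Fin N × Fin N)) (Fd Fc Fp : Matrix ι v ℝ)
    (τ : Fin N → Fin N → ℝ) (x : Fin N → v → ℝ) (i : Fin N) : ι → ℝ :=
  Fd *ᵥ x i + ∑ j, edgeWeight E₀ i j • Fp *ᵥ (x i - x j) + ∑ j, τ i j • Fc *ᵥ (x i - x j)

/-- For success probabilities `π`, the form of the mean row signals plus the variance contributions
of the links is bounded by the modal forms `S m`. The modal inequality `m` is evaluated at the modal
coordinates of the state and of the link signals, and the multiplier is nonnegative on the signals
of each link. -/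
theorem sum_mean_add_variance_le {N : ℕ} {E₀ : Finset (Fin N × Fin N)} (hE₀ : IsUndirected E₀)
    {lam : Fin N → ℝ} {U : Fin N → Fin N → ℝ} (hU : IsModalBasis E₀ lam U)
    {H : Matrix ι ι ℝ} (hH : H.PosSemidef) (S : Fin N → Matrix v v ℝ) (Fd Fc Fp : Matrix ι v ℝ)
    {ρl ρu : ℝ} {P : Matrix ((Fin 3 × ι) ⊕ (Fin 2 × ι)) ((Fin 3 × ι) ⊕ (Fin 2 × ι)) ℝ}
    (hP : P ∈ multiplierSet ι ρl ρu) (hρl : 0 ≤ ρl) (hρu : ρu ≤ 1)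
    (hnom : ∀ m, lam m = 0 → ∀ x, x ≠ 0 →
      Matrix.toBilin' H (Fd *ᵥ x) (Fd *ᵥ x) < Matrix.toBilin' (S m) x x)
    (hmod : ∀ m, lam m ≠ 0 → NegDef (modalMatrix (lam m) (S m) H Fd Fc Fp P))
    (π : Fin N → Fin N → ℝ) (hπ : ∀ i j, (i, j) ∈ E₀ → π i j ∈ Set.Icc ρl ρu)
    (hπs : ∀ i j, (i, j) ∈ E₀ → π i j = π j i) (x : Fin N → v → ℝ) :
    (∑ i, Matrix.toBilin' H
        (rowSignal E₀ Fd Fc Fp (fun i j => edgeWeight E₀ i j * π i j) x i)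
        (rowSignal E₀ Fd Fc Fp (fun i j => edgeWeight E₀ i j * π i j) x i) +
      ∑ i, ∑ j, edgeWeight E₀ i j * (π i j * (1 - π i j)) *
        Matrix.toBilin' H (Fc *ᵥ (x i - x j)) (Fc *ᵥ (x i - x j)) ≤
      ∑ m, Matrix.toBilin' (S m) (∑ i, U i m • x i) (∑ i, U i m • x i)) ∧
    (x ≠ 0 → ∑ i, Matrix.toBilin' H
        (rowSignal E₀ Fd Fc Fp (fun i j => edgeWeight E₀ i j * π i j) x i)
        (rowSignal E₀ Fd Fc Fp (fun i j => edgeWeight E₀ i j * π i j) x i) +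
      ∑ i, ∑ j, edgeWeight E₀ i j * (π i j * (1 - π i j)) *
        Matrix.toBilin' H (Fc *ᵥ (x i - x j)) (Fc *ᵥ (x i - x j)) <
      ∑ m, Matrix.toBilin' (S m) (∑ i, U i m • x i) (∑ i, U i m • x i)) := by
  have hχs : ∀ i j, edgeWeight E₀ j i = edgeWeight E₀ i j := by
    intro i j
    simp only [edgeWeight, hE₀ j i]
  have hχ2 : ∀ i j, edgeWeight E₀ i j * edgeWeight E₀ i j = edgeWeight E₀ i j := by
    intro i j
    unfold edgeWeight
    split_ifs <;> norm_num
  have hχπ : ∀ i j, edgeWeight E₀ j i * π j i = edgeWeight E₀ i j * π i j := by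
    intro i j
    rw [hχs i j]
    unfold edgeWeight
    split_ifs with h
    · rw [hπs i j h]
    · simp
  have hqH : ∀ y, 0 ≤ Matrix.toBilin' H y y := by
    intro y
    rw [Matrix.toBilin'_apply']
    simpa using hH.dotProduct_mulVec_nonneg y
  have hs2 : (√2 : ℝ) * √2 = 2 := Real.mul_self_sqrt (by norm_num)
  have hs2' : (√2 : ℝ)⁻¹ * (√2)⁻¹ = 1 / 2 := by rw [← mul_inv, hs2]; norm_num
  -- The modal coordinates of the state.
  set xh : Fin N → v → ℝ := fun m => ∑ i, U i m • x i with hxh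
  have hxU : ∀ i, ∑ m, U i m • xh m = x i := hU.sum_smul_sum_smul x
  have heigx : ∀ m, ∑ i, ∑ j, (edgeWeight E₀ i j * (U i m - U j m)) • (x i - x j) =
      (2 * lam m) • xh m := by
    intro m
    rw [sum_smul_sub_eq_two_smul _ (fun i j => by rw [hχs]; ring)]
    simp only [hU.eig, hxh, Finset.smul_sum, smul_smul, mul_assoc]
  -- `D` is the transposed incidence matrix of the links applied to the eigenvectors, and the columns
  -- of `V` are the singular vectors on the side of the links. Both directions of a pair of agents
  -- count as links, whence the factor `1 / √2`. A column of `V` for a zero eigenvalue vanishes.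
  set D : Fin N × Fin N → Fin N → ℝ := fun e m =>
    edgeWeight E₀ e.1 e.2 * (U e.1 m - U e.2 m) * (√2)⁻¹ with hD
  have hDD : ∀ m m', ∑ e, D e m * D e m' = if m = m' then lam m else 0 := by
    intro m m'
    have h := sum_sub_smul_eq_two_smul (fun i => U i m)
      (fun i j => edgeWeight E₀ i j * (U i m' - U j m')) (fun i j => by rw [hχs]; ring)
    simp only [smul_eq_mul, hU.eig] at h
    rw [Fintype.sum_prod_type]
    calc ∑ i, ∑ j, D (i, j) m * D (i, j) m' =
        1 / 2 * ∑ i, ∑ j, (U i m - U j m) * (edgeWeight E₀ i j * (U i m' - U j m')) := by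
          simp only [Finset.mul_sum]
          refine Finset.sum_congr rfl fun i _ => Finset.sum_congr rfl fun j _ => ?_
          simp only [hD]
          rw [← hs2']
          linear_combination (U i m - U j m) * (U i m' - U j m') * (√2)⁻¹ * (√2)⁻¹ * hχ2 i j
      _ = lam m' * ∑ i, U i m * U i m' := by
          rw [h]
          simp only [Finset.mul_sum]
          exact Finset.sum_congr rfl fun i _ => by ring
      _ = _ := by
          rw [hU.col]
          split_ifs with hm
          · rw [hm, mul_one]
          · rw [mul_zero]
  have hlam : ∀ m, 0 ≤ lam m := by
    intro m
    have := hDD m m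
    rw [if_pos rfl] at this
    rw [← this]
    exact Finset.sum_nonneg fun e _ => mul_self_nonneg _
  have hD0 : ∀ m, lam m = 0 → ∀ e, D e m = 0 := by
    intro m hm e
    have h := hDD m m
    rw [if_pos rfl, hm] at h
    have := (Finset.sum_eq_zero_iff_of_nonneg fun e _ => mul_self_nonneg (D e m)).mp h e
      (Finset.mem_univ e)
    exact mul_self_eq_zero.mp this
  set V : Fin N × Fin N → Fin N → ℝ := fun e m => D e m * (√(lam m))⁻¹ with hV
  have hlam2 : ∀ m, √(lam m) * √(lam m) = lam m := fun m => Real.mul_self_sqrt (hlam m)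
  have hlams : ∀ m, lam m ≠ 0 → √(lam m) ≠ 0 := fun m hm =>
    (Real.sqrt_pos.mpr (lt_of_le_of_ne (hlam m) hm.symm)).ne'
  have hDV : ∀ e m, D e m = √(lam m) * V e m := by
    intro e m
    by_cases hm : lam m = 0
    · rw [hD0 m hm, hm]
      simp
    · simp only [hV]
      field_simp [hlams m hm]
  have hV0 : ∀ m, lam m = 0 → ∀ e, V e m = 0 := by
    intro m hm e
    simp only [hV, hD0 m hm, zero_mul]
  have hVV : ∀ m m', ∑ e, V e m * V e m' =
      if m = m' then (if lam m = 0 then 0 else 1) else 0 := by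
    intro m m'
    have : ∑ e, V e m * V e m' = (√(lam m))⁻¹ * (√(lam m'))⁻¹ * ∑ e, D e m * D e m' := by
      rw [Finset.mul_sum]
      exact Finset.sum_congr rfl fun e _ => by simp only [hV]; ring
    rw [this, hDD]
    split_ifs with h1 h2
    · rw [h2, mul_zero]
    · subst h1
      rw [← mul_inv, hlam2, inv_mul_cancel₀ h2]
    · rw [mul_zero]
  -- The signals `ve` of the links, with the responses `a² v`, `a b v`, `a v` of the uncertainty.
  set ve : Fin N × Fin N → ι → ℝ := fun e =>
    (edgeWeight E₀ e.1 e.2 * (√2)⁻¹) • Fc *ᵥ (x e.1 - x e.2) with hve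
  set a : Fin N × Fin N → ℝ := fun e => √(π e.1 e.2) with ha
  set b : Fin N × Fin N → ℝ := fun e => √(1 - π e.1 e.2) with hb
  set ζ : Fin N × Fin N → (Fin 3 × ι) ⊕ (Fin 2 × ι) → ℝ := fun e =>
    Sum.elim (fun r => ![a e * a e, b e * a e, a e] r.1 * ve e r.2)
      fun r => ![a e, 1] r.1 * ve e r.2 with hζ
  have hve0 : ∀ e, e ∉ E₀ → ve e = 0 := by
    intro e he
    simp only [hve, edgeWeight]
    rw [if_neg he, zero_mul, zero_smul]
  have ha2 : ∀ e ∈ E₀, a e * a e = π e.1 e.2 := fun e he =>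
    Real.mul_self_sqrt (hρl.trans (hπ _ _ he).1)
  have hb2 : ∀ e ∈ E₀, b e * b e = 1 - π e.1 e.2 := fun e he =>
    Real.mul_self_sqrt (sub_nonneg.mpr ((hπ _ _ he).2.trans hρu))
  have hPζ : ∀ e, 0 ≤ Matrix.toBilin' P (ζ e) (ζ e) := by
    intro e
    by_cases he : e ∈ E₀
    · exact toBilin'_nonneg_of_mem_multiplierSet hP (Real.sqrt_nonneg _) (Real.sqrt_nonneg _)
        (by rw [pow_two, ha2 e he]; exact hπ _ _ he)
        (by rw [pow_two, pow_two, ha2 e he, hb2 e he]) (ve e)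
    · have : ζ e = 0 := by
        simp only [hζ, hve0 e he]
        ext (r | r) <;> simp
      rw [this]
      simp
  have hvhat : ∀ m, ∑ e, V e m • ve e = √(lam m) • Fc *ᵥ xh m := by
    intro m
    by_cases hm : lam m = 0
    · simp [hV0 m hm, hm]
    have h1 : ∑ e, D e m • ve e = lam m • Fc *ᵥ xh m := by
      have h2 := congrArg (fun y => ((1 : ℝ) / 2) • Fc *ᵥ y) (heigx m)
      simp only [Matrix.mulVec_smul, smul_smul] at h2
      rw [show (1 : ℝ) / 2 * (2 * lam m) = lam m by ring] at h2
      rw [← h2, Fintype.sum_prod_type]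
      simp only [Matrix.mulVec_sum, Matrix.mulVec_smul, Finset.smul_sum, smul_smul, hD, hve]
      refine Finset.sum_congr rfl fun i _ => Finset.sum_congr rfl fun j _ => ?_
      congr 1
      rw [← hs2']
      linear_combination (U i m - U j m) * (√2)⁻¹ * (√2)⁻¹ * hχ2 i j
    have h3 : ∑ e, V e m • ve e = (√(lam m))⁻¹ • ∑ e, D e m • ve e := by
      rw [Finset.smul_sum]
      refine Finset.sum_congr rfl fun e _ => ?_
      simp only [hV, smul_smul]
      rw [mul_comm]
    rw [h3, h1, smul_smul]
    congr 1
    exact (inv_mul_eq_iff_eq_mul₀ (hlams m hm)).mpr (hlam2 m).symm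
  have hvrem : ∀ e, ∑ m, V e m • ∑ e', V e' m • ve e' = ve e := by
    intro e
    simp only [hvhat, smul_smul]
    have : ∀ m, V e m * √(lam m) = D e m := fun m => by rw [hDV]; ring
    simp only [this, hve]
    rw [← hxU e.1, ← hxU e.2, ← Finset.sum_sub_distrib]
    simp only [← sub_smul, Matrix.mulVec_sum, Matrix.mulVec_smul, Finset.smul_sum, smul_smul, hD]
    refine Finset.sum_congr rfl fun m _ => ?_
    congr 1
    ring
  -- The combined form of the signals of the links.
  set β : LinearMap.BilinForm ℝ ((Fin 3 × ι) ⊕ (Fin 2 × ι) → ℝ) :=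
    (2 : ℝ) • (Matrix.toBilin' H).comp
      (LinearMap.funLeft ℝ ℝ fun c : ι => (Sum.inl (1, c) : (Fin 3 × ι) ⊕ (Fin 2 × ι)))
      (LinearMap.funLeft ℝ ℝ fun c : ι => (Sum.inl (1, c) : (Fin 3 × ι) ⊕ (Fin 2 × ι))) +
    Matrix.toBilin' P with hβ
  have hβa : ∀ y, β y y = 2 * Matrix.toBilin' H (fun c => y (Sum.inl (1, c)))
      (fun c => y (Sum.inl (1, c))) + Matrix.toBilin' P y y := fun y => rfl
  have hgram := sum_bilin_eq_sum_proj_add_sum_rem β V (fun m => if lam m = 0 then 0 else 1) hVV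
    (fun m e => by
      by_cases hm : lam m = 0
      · simp [hV0 m hm]
      · simp [hm]) ζ
  set ζh : Fin N → (Fin 3 × ι) ⊕ (Fin 2 × ι) → ℝ := fun m => ∑ e, V e m • ζ e with hζh
  set r : Fin N × Fin N → (Fin 3 × ι) ⊕ (Fin 2 × ι) → ℝ := fun e =>
    ζ e - ∑ m, V e m • ζh m with hr
  have hmodform : ∀ m, lam m ≠ 0 → ∀ (y : v → ℝ) (w : Fin 3 × ι → ℝ), Sum.elim y w ≠ 0 →
      Sum.elim y w ⬝ᵥ (modalMatrix (lam m) (S m) H Fd Fc Fp P *ᵥ Sum.elim y w) < 0 := by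
    intro m hm y w hyw
    have := (hmod m hm).dotProduct_mulVec_pos hyw
    rw [star_trivial, Matrix.neg_mulVec, dotProduct_neg] at this
    linarith
  have hmodform' : ∀ m, lam m ≠ 0 → ∀ (y : v → ℝ) (w : Fin 3 × ι → ℝ),
      Sum.elim y w ⬝ᵥ (modalMatrix (lam m) (S m) H Fd Fc Fp P *ᵥ Sum.elim y w) ≤ 0 := by
    intro m hm y w
    by_cases hyw : Sum.elim y w = 0
    · rw [hyw]
      simp
    · exact (hmodform m hm y w hyw).le
  have hζ2 : ∀ e c, ζ e (Sum.inr (0, c)) = ζ e (Sum.inl (2, c)) := fun e c => by simp [hζ]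
  have hζv : ∀ e c, ζ e (Sum.inr (1, c)) = ve e c := fun e c => by simp [hζ]
  have hζh2 : ∀ m c, ζh m (Sum.inr (0, c)) = ζh m (Sum.inl (2, c)) := fun m c => by
    simp only [hζh, Finset.sum_apply, Pi.smul_apply, hζ2]
  have hζhv : ∀ m c, ζh m (Sum.inr (1, c)) = (∑ e, V e m • ve e) c := fun m c => by
    simp only [hζh, Finset.sum_apply, Pi.smul_apply, hζv]
  have hζhform : ∀ m, (Sum.elim (fun k => ζh m (Sum.inl k)) fun k =>
      ![ζh m (Sum.inl (2, k.2)), √(lam m) * (Fc *ᵥ xh m) k.2] k.1) = ζh m := by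
    intro m
    ext (k | ⟨k, c⟩)
    · rfl
    · fin_cases k
      · exact (hζh2 m c).symm
      · have := hζhv m c
        rw [hvhat] at this
        exact this.symm
  -- The component of the remainder from `ve` vanishes, since `ve` is in the span of the columns of
  -- `V`. So a modal inequality with vanishing state applies to it.
  have hrem : ∀ e, β (r e) (r e) ≤ 0 := by
    intro e
    by_cases hex : ∃ m, lam m ≠ 0
    · obtain ⟨m, hm⟩ := hex
      have h := hmodform' m hm 0 (fun k => r e (Sum.inl k))
      rw [dotProduct_modalMatrix] at h
      have e1 : (Sum.elim (fun k => r e (Sum.inl k)) fun k =>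
          ![r e (Sum.inl (2, k.2)), √(lam m) * (Fc *ᵥ (0 : v → ℝ)) k.2] k.1) = r e := by
        ext (k | ⟨k, c⟩)
        · rfl
        · fin_cases k
          · simp [hr, hζ2, hζh2]
          · have h1 := congrFun (hvrem e) c
            simp only [Finset.sum_apply, Pi.smul_apply, smul_eq_mul] at h1
            simp [hr, hζhv, hζv, h1]
      rw [e1] at h
      have h2 := hqH ((Fd + lam m • Fp) *ᵥ 0 + √(lam m) • fun c => r e (Sum.inl (0, c)))
      rw [hβa]
      simp only [map_zero, neg_zero, zero_add] at h
      linarith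
    · push Not at hex
      have hve' : ve e = 0 := by
        rw [← hvrem e]
        simp [hV0 _ (hex _)]
      have hr0 : r e = 0 := by
        have : ζ e = 0 := by
          simp only [hζ, hve']
          ext (k | k) <;> simp
        simp only [hr, this, hV0 _ (hex _)]
        simp
      rw [hr0]
      simp
  -- The mean row signals in modal coordinates.
  set yb : Fin N → ι → ℝ :=
    rowSignal E₀ Fd Fc Fp (fun i j => edgeWeight E₀ i j * π i j) x with hyb
  have hyh : ∀ m, ∑ i, U i m • yb i =
      (Fd + lam m • Fp) *ᵥ xh m + √(lam m) • fun c => ζh m (Sum.inl (0, c)) := by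
    intro m
    have t1 : ∑ i, U i m • Fd *ᵥ x i = Fd *ᵥ xh m := by
      simp only [hxh, Matrix.mulVec_sum, Matrix.mulVec_smul]
    have t2 : ∑ i, U i m • ∑ j, edgeWeight E₀ i j • Fp *ᵥ (x i - x j) =
        lam m • Fp *ᵥ xh m := by
      have h := sum_sub_smul_eq_two_smul (fun i => U i m)
        (fun i j => edgeWeight E₀ i j • Fp *ᵥ (x i - x j)) (fun i j => by
          rw [hχs, ← smul_neg, ← Matrix.mulVec_neg, neg_sub])
      have h2 := congrArg (fun y => ((1 : ℝ) / 2) • Fp *ᵥ y) (heigx m)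
      have h3 := congrArg (fun y => ((1 : ℝ) / 2) • y) h
      simp only [smul_smul] at h3
      rw [show (1 : ℝ) / 2 * 2 = 1 by norm_num, one_smul] at h3
      rw [← h3]
      simp only [Matrix.mulVec_smul, smul_smul] at h2
      rw [show (1 : ℝ) / 2 * (2 * lam m) = lam m by ring] at h2
      rw [← h2]
      simp only [Matrix.mulVec_sum, Matrix.mulVec_smul]
      congr 1
      refine Finset.sum_congr rfl fun i _ => Finset.sum_congr rfl fun j _ => ?_
      rw [mul_comm]
    have t3 : ∑ i, U i m • ∑ j, (edgeWeight E₀ i j * π i j) • Fc *ᵥ (x i - x j) =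
        √(lam m) • fun c => ζh m (Sum.inl (0, c)) := by
      have h := sum_sub_smul_eq_two_smul (fun i => U i m)
        (fun i j => (edgeWeight E₀ i j * π i j) • Fc *ᵥ (x i - x j)) (fun i j => by
          rw [hχπ, ← smul_neg, ← Matrix.mulVec_neg, neg_sub])
      have h3 := congrArg (fun y => ((1 : ℝ) / 2) • y) h
      simp only [smul_smul] at h3
      rw [show (1 : ℝ) / 2 * 2 = 1 by norm_num, one_smul] at h3
      rw [← h3]
      ext c
      simp only [hζh, Finset.sum_apply, Pi.smul_apply, smul_eq_mul, Finset.mul_sum,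
        Fintype.sum_prod_type]
      refine Finset.sum_congr rfl fun i _ => Finset.sum_congr rfl fun j _ => ?_
      rw [← mul_assoc √(lam m), ← hDV]
      by_cases he : (i, j) ∈ E₀
      · simp only [hζ, Sum.elim_inl, Matrix.cons_val_zero, ha2 _ he, hve, hD, Pi.smul_apply,
          smul_eq_mul]
        rw [← hs2']
        linear_combination (-(U i m - U j m) * (√2)⁻¹ * (√2)⁻¹ * π i j *
          (Fc *ᵥ (x i - x j)) c) * hχ2 i j
      · simp [hζ, hve0 _ he, edgeWeight, he]
    simp only [hyb, rowSignal, smul_add, Finset.sum_add_distrib, t1, t2, t3, Matrix.add_mulVec,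
      Matrix.smul_mulVec]
  have hpars := hU.sum_bilin_eq (Matrix.toBilin' H) yb
  have hvar : ∑ i, ∑ j, edgeWeight E₀ i j * (π i j * (1 - π i j)) *
        Matrix.toBilin' H (Fc *ᵥ (x i - x j)) (Fc *ᵥ (x i - x j)) ≤ ∑ e, β (ζ e) (ζ e) := by
    rw [Fintype.sum_prod_type]
    refine Finset.sum_le_sum fun i _ => Finset.sum_le_sum fun j _ => ?_
    rw [hβa]
    refine le_trans (le_of_eq ?_) (le_add_of_nonneg_right (hPζ (i, j)))
    have e1 : (fun c => ζ (i, j) (Sum.inl (1, c))) = (b (i, j) * a (i, j)) • ve (i, j) := by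
      ext c
      simp [hζ]
    rw [e1]
    by_cases he : (i, j) ∈ E₀
    · simp only [hve, map_smul, LinearMap.smul_apply, smul_eq_mul]
      have h1 := ha2 _ he
      have h2 := hb2 _ he
      simp only at h1 h2
      rw [← h2, ← h1]
      linear_combination (-2 * b (i, j) * a (i, j) * b (i, j) * a (i, j) * edgeWeight E₀ i j *
          edgeWeight E₀ i j *
          Matrix.toBilin' H (Fc *ᵥ (x i - x j)) (Fc *ᵥ (x i - x j))) * hs2' -
        (b (i, j) * a (i, j) * b (i, j) * a (i, j) *
          Matrix.toBilin' H (Fc *ᵥ (x i - x j)) (Fc *ᵥ (x i - x j))) * hχ2 i j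
    · simp [hve0 _ he, edgeWeight, he]
  have hζh0 : ∀ m, lam m = 0 → ζh m = 0 := by
    intro m hm
    simp [hζh, hV0 m hm]
  have hmode_lt : ∀ m, xh m ≠ 0 → Matrix.toBilin' H (∑ i, U i m • yb i) (∑ i, U i m • yb i) +
      β (ζh m) (ζh m) < Matrix.toBilin' (S m) (xh m) (xh m) := by
    intro m hx
    rw [hyh]
    by_cases hm : lam m = 0
    · have := hnom m hm (xh m) hx
      simp only [hζh0 m hm, hm]
      simpa using this
    · have h := hmodform m hm (xh m) (fun k => ζh m (Sum.inl k)) (fun h0 => hx (by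
        ext c
        simpa using congrFun h0 (Sum.inl c)))
      rw [dotProduct_modalMatrix, hζhform] at h
      rw [hβa]
      linarith
  have hmode_le : ∀ m, Matrix.toBilin' H (∑ i, U i m • yb i) (∑ i, U i m • yb i) +
      β (ζh m) (ζh m) ≤ Matrix.toBilin' (S m) (xh m) (xh m) := by
    intro m
    by_cases hx : xh m = 0
    · rw [hyh]
      by_cases hm : lam m = 0
      · simp [hζh0 m hm, hm, hx]
      · have h := hmodform' m hm (xh m) (fun k => ζh m (Sum.inl k))
        rw [dotProduct_modalMatrix, hζhform] at h
        rw [hβa]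
        linarith
    · exact (hmode_lt m hx).le
  have htotal : ∑ i, Matrix.toBilin' H (yb i) (yb i) +
      ∑ i, ∑ j, edgeWeight E₀ i j * (π i j * (1 - π i j)) *
        Matrix.toBilin' H (Fc *ᵥ (x i - x j)) (Fc *ᵥ (x i - x j)) ≤
      ∑ m, (Matrix.toBilin' H (∑ i, U i m • yb i) (∑ i, U i m • yb i) + β (ζh m) (ζh m)) := by
    rw [Finset.sum_add_distrib, ← hpars]
    have : ∑ e, β (r e) (r e) ≤ 0 := Finset.sum_nonpos fun e _ => hrem e
    linarith
  refine ⟨htotal.trans (Finset.sum_le_sum fun m _ => hmode_le m), fun hx => ?_⟩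
  refine lt_of_le_of_lt htotal (Finset.sum_lt_sum (fun m _ => hmode_le m) ?_)
  by_contra! hall
  refine hx (funext fun i => ?_)
  rw [← hxU i]
  refine Finset.sum_eq_zero fun m _ => ?_
  by_cases hxm : xh m = 0
  · rw [hxm, smul_zero]
  · exact absurd (hmode_lt m hxm) (not_lt.mpr (hall m (Finset.mem_univ m)))

end ModalBound

/-! ### Decomposable systems -/

section Laplacian

variable {N : ℕ}

theorem sum_laplacian_smul (E : Finset (Fin N × Fin N)) {M : Type*} [AddCommGroup M] [Module ℝ M]
    (y : Fin N → M) (i : Fin N) :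
    ∑ j, laplacian E i j • y j = ∑ j, edgeWeight E i j • (y i - y j) := by
  have hdiag : laplacian E i i = ∑ j ∈ Finset.univ.erase i, edgeWeight E i j := by
    simp only [laplacian, Matrix.of_apply, if_true, ← Finset.sum_neg_distrib, edgeWeight]
    exact Finset.sum_congr rfl fun j _ => by split_ifs <;> simp
  have hoff : ∀ j ∈ Finset.univ.erase i, laplacian E i j = -edgeWeight E i j := by
    intro j hj
    have hij : i ≠ j := fun h => (Finset.ne_of_mem_erase hj) h.symm
    simp only [laplacian, Matrix.of_apply, if_neg hij, edgeWeight]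
    split_ifs <;> simp
  rw [← Finset.add_sum_erase _ _ (Finset.mem_univ i),
    ← Finset.add_sum_erase (s := Finset.univ) (f := fun j => edgeWeight E i j • (y i - y j))
      (Finset.mem_univ i), hdiag, sub_self, smul_zero, zero_add, Finset.sum_smul,
    ← Finset.sum_add_distrib]
  refine Finset.sum_congr rfl fun j hj => ?_
  rw [hoff j hj]
  module

/-- The spectral theorem for the Laplacian of an undirected graph. -/
theorem IsUndirected.isModalBasis {E : Finset (Fin N × Fin N)} (hE : IsUndirected E) :
    IsModalBasis E hE.isHermitian_laplacian.eigenvalues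
      (fun i m => hE.isHermitian_laplacian.eigenvectorBasis m i) where
  col m m' := by
    have h := orthonormal_iff_ite.mp hE.isHermitian_laplacian.eigenvectorBasis.orthonormal m m'
    rw [← h]
    simp [PiLp.inner_apply, mul_comm]
  row i j := by
    have h := hE.isHermitian_laplacian.eigenvectorBasis.sum_inner_mul_inner
      (EuclideanSpace.single i (1 : ℝ)) (EuclideanSpace.single j 1)
    simpa [EuclideanSpace.inner_single_left, EuclideanSpace.inner_single_right,
      Pi.single_apply, eq_comm] using h
  eig i m := by
    have h := congrFun (hE.isHermitian_laplacian.mulVec_eigenvectorBasis m) i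
    have h2 := sum_laplacian_smul E
      (fun j => hE.isHermitian_laplacian.eigenvectorBasis m j) i
    simp only [smul_eq_mul] at h2
    rw [← h2]
    simpa [Matrix.mulVec, dotProduct] using h

/-- A decomposable matrix acts agent by agent, through the differences to the neighbours. -/
theorem Components.assemble_mulVec {m n : ℕ} (M : Components m n)
    (E₀ E : Finset (Fin N × Fin N)) (x : Fin N × Fin n → ℝ) (i : Fin N) (a : Fin m) :
    (M.assemble E₀ E *ᵥ x) (i, a) =
      rowSignal E₀ M.d M.c M.p (edgeWeight E) (fun i b => x (i, b)) i a := by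
  have hk : ∀ (L : Matrix (Fin N) (Fin N) ℝ) (Q : Matrix (Fin m) (Fin n) ℝ),
      ((L ⊗ₖ Q) *ᵥ x) (i, a) = (∑ j, L i j • Q *ᵥ fun b => x (j, b)) a := by
    intro L Q
    simp only [Matrix.mulVec, dotProduct, Fintype.sum_prod_type, Matrix.kroneckerMap_apply,
      Finset.sum_apply, Pi.smul_apply, smul_eq_mul, Finset.mul_sum, mul_assoc]
  simp only [Components.assemble, Matrix.add_mulVec, Pi.add_apply, hk, rowSignal,
    sum_laplacian_smul, Matrix.one_apply, ite_smul, one_smul, zero_smul, Finset.sum_ite_eq,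
    Finset.mem_univ, if_true, ← Matrix.mulVec_sub]
  ring

theorem rowSignal_fromRows {ι₁ ι₂ v : Type*} [Fintype v] (E₀ : Finset (Fin N × Fin N))
    (Fd Fc Fp : Matrix ι₁ v ℝ) (Gd Gc Gp : Matrix ι₂ v ℝ) (τ : Fin N → Fin N → ℝ)
    (x : Fin N → v → ℝ) (i : Fin N) :
    rowSignal E₀ (Matrix.fromRows Fd Gd) (Matrix.fromRows Fc Gc) (Matrix.fromRows Fp Gp) τ x i =
      Sum.elim (rowSignal E₀ Fd Fc Fp τ x i) (rowSignal E₀ Gd Gc Gp τ x i) := by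
  ext (a | a) <;>
    simp [rowSignal, Matrix.fromRows_mulVec, Finset.sum_apply]

/-- Averaging the row signals over random sets of transmitting links, with uncorrelated links
within each row of the Laplacian. -/
theorem sum_weight_rowSignal {ι v K : Type*} [Fintype ι] [DecidableEq ι] [Fintype v]
    [Fintype K] (E₀ : Finset (Fin N × Fin N)) (H : Matrix ι ι ℝ) (Fd Fc Fp : Matrix ι v ℝ)
    (E : K → Finset (Fin N × Fin N)) (hE : ∀ k, E k ⊆ E₀) (ν : K → ℝ) (hν : ∑ k, ν k = 1)
    (π : Fin N → Fin N → ℝ)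
    (hmean : ∀ i j, (i, j) ∈ E₀ → ∑ k, ν k * edgeWeight (E k) i j = π i j)
    (hcov : ∀ i j l, (i, j) ∈ E₀ → (i, l) ∈ E₀ → j ≠ l →
      ∑ k, ν k * (edgeWeight (E k) i j * edgeWeight (E k) i l) = π i j * π i l)
    (x : Fin N → v → ℝ) :
    ∑ k, ν k * ∑ i, Matrix.toBilin' H (rowSignal E₀ Fd Fc Fp (edgeWeight (E k)) x i)
      (rowSignal E₀ Fd Fc Fp (edgeWeight (E k)) x i) =
    ∑ i, Matrix.toBilin' H
        (rowSignal E₀ Fd Fc Fp (fun i j => edgeWeight E₀ i j * π i j) x i)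
        (rowSignal E₀ Fd Fc Fp (fun i j => edgeWeight E₀ i j * π i j) x i) +
      ∑ i, ∑ j, edgeWeight E₀ i j * (π i j * (1 - π i j)) *
        Matrix.toBilin' H (Fc *ᵥ (x i - x j)) (Fc *ᵥ (x i - x j)) := by
  have h0 : ∀ i j, (i, j) ∉ E₀ → ∀ k, edgeWeight (E k) i j = 0 := fun i j h k =>
    if_neg fun h' => h (hE k h')
  have h1 : ∀ i j, (i, j) ∉ E₀ → edgeWeight E₀ i j = 0 := fun i j h => if_neg h
  simp only [Finset.mul_sum]
  rw [Finset.sum_comm, ← Finset.sum_add_distrib]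
  refine Finset.sum_congr rfl fun i _ => ?_
  simp only [rowSignal]
  rw [sum_weight_bilin_eq (Matrix.toBilin' H) ν hν (fun j k => edgeWeight (E k) i j)
    (fun j => edgeWeight E₀ i j * π i j)]
  · congr 1
    refine Finset.sum_congr rfl fun j _ => ?_
    unfold edgeWeight
    split_ifs <;> ring
  · intro j
    by_cases h : (i, j) ∈ E₀
    · rw [hmean i j h]
      simp [edgeWeight, h]
    · simp [h0 i j h, h1 i j h]
  · intro j k
    simp only [edgeWeight]
    split_ifs <;> norm_num
  · intro j l hjl
    by_cases h : (i, j) ∈ E₀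
    · by_cases h' : (i, l) ∈ E₀
      · rw [hcov i j l h h' hjl]
        simp [edgeWeight, h, h']
      · simp [h0 i l h', h1 i l h']
    · simp [h0 i j h, h1 i j h]

end Laplacian

section Lyapunov

variable {N nx nw nz : ℕ}

/-- The quadratic form of `I ⊗ Y`. -/
noncomputable def agentForm (Y : Matrix (Fin nx) (Fin nx) ℝ) (x : Fin N × Fin nx → ℝ) : ℝ :=
  ∑ i, Matrix.toBilin' Y (fun a => x (i, a)) (fun a => x (i, a))

theorem continuous_agentForm (Y : Matrix (Fin nx) (Fin nx) ℝ) :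
    Continuous (agentForm (N := N) Y) := by
  unfold agentForm
  simp only [Matrix.toBilin'_apply', dotProduct, Matrix.mulVec]
  fun_prop

theorem agentForm_smul (Y : Matrix (Fin nx) (Fin nx) ℝ) (c : ℝ) (x : Fin N × Fin nx → ℝ) :
    agentForm Y (c • x) = c ^ 2 * agentForm Y x := by
  unfold agentForm
  rw [Finset.mul_sum]
  refine Finset.sum_congr rfl fun i _ => ?_
  have : (fun a => (c • x) (i, a)) = c • fun a => x (i, a) := rfl
  rw [this, map_smul, map_smul, LinearMap.smul_apply, smul_eq_mul, smul_eq_mul]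
  ring

theorem agentForm_nonneg {Y : Matrix (Fin nx) (Fin nx) ℝ} (hY : Y.PosSemidef)
    (x : Fin N × Fin nx → ℝ) : 0 ≤ agentForm Y x := by
  refine Finset.sum_nonneg fun i _ => ?_
  rw [Matrix.toBilin'_apply']
  simpa using hY.dotProduct_mulVec_nonneg fun a => x (i, a)

theorem agentForm_add_dotProduct (Y : Matrix (Fin nx) (Fin nx) ℝ) {n : ℕ}
    (M₁ : Components nx n) (M₂ : Components nz n) (E₀ E : Finset (Fin N × Fin N))
    (x : Fin N × Fin n → ℝ) :
    agentForm Y (M₁.assemble E₀ E *ᵥ x) + (M₂.assemble E₀ E *ᵥ x) ⬝ᵥ (M₂.assemble E₀ E *ᵥ x) =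
      ∑ i, Matrix.toBilin' (Matrix.fromBlocks Y 0 0 1)
        (rowSignal E₀ (Matrix.fromRows M₁.d M₂.d) (Matrix.fromRows M₁.c M₂.c)
          (Matrix.fromRows M₁.p M₂.p) (edgeWeight E) (fun i b => x (i, b)) i)
        (rowSignal E₀ (Matrix.fromRows M₁.d M₂.d) (Matrix.fromRows M₁.c M₂.c)
          (Matrix.fromRows M₁.p M₂.p) (edgeWeight E) (fun i b => x (i, b)) i) := by
  simp only [agentForm, dotProduct, Fintype.sum_prod_type, Components.assemble_mulVec,
    rowSignal_fromRows]
  rw [← Finset.sum_add_distrib]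
  refine Finset.sum_congr rfl fun i _ => ?_
  simp only [Matrix.toBilin'_apply', Matrix.fromBlocks_mulVec, Sum.elim_comp_inl,
    Sum.elim_comp_inr, Matrix.zero_mulVec, add_zero, zero_add, sumElim_dotProduct_sumElim,
    Matrix.one_mulVec]
  rfl

theorem posSemidef_fromBlocks_one {Y : Matrix (Fin nx) (Fin nx) ℝ} (hY : Y.PosSemidef) :
    (Matrix.fromBlocks Y 0 0 (1 : Matrix (Fin nz) (Fin nz) ℝ)).PosSemidef := by
  refine Matrix.PosSemidef.of_dotProduct_mulVec_nonneg ?_ fun x => ?_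
  · exact Matrix.IsHermitian.fromBlocks hY.1 (by simp) Matrix.isHermitian_one
  · obtain ⟨u, w, rfl⟩ : ∃ u w, x = Sum.elim u w := ⟨_, _, (Sum.elim_comp_inl_inr x).symm⟩
    have h1 := hY.dotProduct_mulVec_nonneg u
    have h2 := real_dotProduct_self_nonneg w
    rw [star_trivial] at h1 ⊢
    simp only [Matrix.fromBlocks_mulVec, Sum.elim_comp_inl, Sum.elim_comp_inr,
      Matrix.zero_mulVec, add_zero, zero_add, sumElim_dotProduct_sumElim, Matrix.one_mulVec]
    exact add_nonneg h1 h2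

/-- The modal inequalities bound the mean energy after one step of a decomposable system, for
every law `ν` of the mode with uncorrelated links in each row and symmetric success probabilities
in `[ρl, ρu]`. -/
theorem sum_weight_energy_le {n : ℕ} {K : Type*} [Fintype K]
    {E₀ : Finset (Fin N × Fin N)} (hE₀ : IsUndirected E₀)
    {lam : Fin N → ℝ} {U : Fin N → Fin N → ℝ} (hU : IsModalBasis E₀ lam U)
    {Y : Matrix (Fin nx) (Fin nx) ℝ} (hY : Y.PosSemidef) (S : Fin N → Matrix (Fin n) (Fin n) ℝ)
    (M₁ : Components nx n) (M₂ : Components nz n) {ρl ρu : ℝ}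
    {P : Matrix ((Fin 3 × (Fin nx ⊕ Fin nz)) ⊕ (Fin 2 × (Fin nx ⊕ Fin nz)))
      ((Fin 3 × (Fin nx ⊕ Fin nz)) ⊕ (Fin 2 × (Fin nx ⊕ Fin nz))) ℝ}
    (hP : P ∈ multiplierSet (Fin nx ⊕ Fin nz) ρl ρu) (hρl : 0 ≤ ρl) (hρu : ρu ≤ 1)
    (hnom : ∀ m, lam m = 0 → NegDef (M₁.dᵀ * Y * M₁.d - S m + M₂.dᵀ * M₂.d))
    (hmod : ∀ m, lam m ≠ 0 → NegDef (modalMatrix (lam m) (S m) (Matrix.fromBlocks Y 0 0 1)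
      (Matrix.fromRows M₁.d M₂.d) (Matrix.fromRows M₁.c M₂.c) (Matrix.fromRows M₁.p M₂.p) P))
    (E : K → Finset (Fin N × Fin N)) (hE : ∀ k, E k ⊆ E₀) (ν : K → ℝ) (hν : ∑ k, ν k = 1)
    (π : Fin N → Fin N → ℝ) (hπ : ∀ i j, (i, j) ∈ E₀ → π i j ∈ Set.Icc ρl ρu)
    (hπs : ∀ i j, (i, j) ∈ E₀ → π i j = π j i)
    (hmean : ∀ i j, (i, j) ∈ E₀ → ∑ k, ν k * edgeWeight (E k) i j = π i j)
    (hcov : ∀ i j l, (i, j) ∈ E₀ → (i, l) ∈ E₀ → j ≠ l →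
      ∑ k, ν k * (edgeWeight (E k) i j * edgeWeight (E k) i l) = π i j * π i l)
    (x : Fin N × Fin n → ℝ) :
    (∑ k, ν k * (agentForm Y (M₁.assemble E₀ (E k) *ᵥ x) +
        (M₂.assemble E₀ (E k) *ᵥ x) ⬝ᵥ (M₂.assemble E₀ (E k) *ᵥ x)) ≤
      ∑ m, Matrix.toBilin' (S m) (∑ i, U i m • fun b => x (i, b))
        (∑ i, U i m • fun b => x (i, b))) ∧
    (x ≠ 0 → ∑ k, ν k * (agentForm Y (M₁.assemble E₀ (E k) *ᵥ x) +
        (M₂.assemble E₀ (E k) *ᵥ x) ⬝ᵥ (M₂.assemble E₀ (E k) *ᵥ x)) <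
      ∑ m, Matrix.toBilin' (S m) (∑ i, U i m • fun b => x (i, b))
        (∑ i, U i m • fun b => x (i, b))) := by
  simp only [agentForm_add_dotProduct]
  rw [sum_weight_rowSignal E₀ _ _ _ _ E hE ν hν π hmean hcov]
  have key := sum_mean_add_variance_le hE₀ hU (posSemidef_fromBlocks_one (nz := nz) hY) S
    (Matrix.fromRows M₁.d M₂.d) (Matrix.fromRows M₁.c M₂.c) (Matrix.fromRows M₁.p M₂.p) hP hρl
    hρu (fun m hm y hy => ?_) hmod π hπ hπs fun i b => x (i, b)
  · refine ⟨key.1, fun hx => key.2 fun h => hx ?_⟩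
    ext ⟨i, b⟩
    exact congrFun (congrFun h i) b
  · have h := (hnom m hm).dotProduct_mulVec_pos hy
    rw [star_trivial, Matrix.neg_mulVec, dotProduct_neg, Matrix.add_mulVec, Matrix.sub_mulVec,
      dotProduct_add, dotProduct_sub, dotProduct_transpose_mul_mul_mulVec] at h
    have h2 := dotProduct_transpose_mul_mul_mulVec M₂.d 1 y
    rw [Matrix.mul_one, Matrix.one_mulVec] at h2
    rw [h2] at h
    simp only [Matrix.toBilin'_apply', Matrix.fromRows_mulVec, Matrix.fromBlocks_mulVec,
      Sum.elim_comp_inl, Sum.elim_comp_inr, Matrix.zero_mulVec, add_zero, zero_add,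
      sumElim_dotProduct_sumElim, Matrix.one_mulVec]
    linarith

theorem IsModalBasis.sum_agentForm {E : Finset (Fin N × Fin N)} {lam : Fin N → ℝ}
    {U : Fin N → Fin N → ℝ} (hU : IsModalBasis E lam U) (Y : Matrix (Fin nx) (Fin nx) ℝ)
    (x : Fin N × Fin nx → ℝ) :
    ∑ m, Matrix.toBilin' Y (∑ i, U i m • fun b => x (i, b)) (∑ i, U i m • fun b => x (i, b)) =
      agentForm Y x :=
  (hU.sum_bilin_eq (Matrix.toBilin' Y) fun i b => x (i, b)).symm

/-- The sum of a modal quadratic form over the standard basis. -/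
theorem IsModalBasis.sum_single {n : ℕ} {E : Finset (Fin N × Fin N)} {lam : Fin N → ℝ}
    {U : Fin N → Fin N → ℝ} (hU : IsModalBasis E lam U) (S : Fin N → Matrix (Fin n) (Fin n) ℝ) :
    ∑ s : Fin N × Fin n, ∑ m, Matrix.toBilin' (S m)
      (∑ i, U i m • fun b => (Pi.single s 1 : Fin N × Fin n → ℝ) (i, b))
      (∑ i, U i m • fun b => (Pi.single s 1 : Fin N × Fin n → ℝ) (i, b)) =
    ∑ m, (S m).trace := by
  have h : ∀ (i₀ : Fin N) (a : Fin n) (m : Fin N),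
      (∑ i, U i m • fun b => (Pi.single (i₀, a) 1 : Fin N × Fin n → ℝ) (i, b)) =
        U i₀ m • Pi.single a 1 := by
    intro i₀ a m
    ext b
    simp only [Finset.sum_apply, Pi.smul_apply, smul_eq_mul, Pi.single_apply, Prod.mk.injEq]
    rw [Finset.sum_eq_single i₀]
    · simp
    · intro i _ hi
      simp [hi]
    · simp
  rw [Finset.sum_comm]
  refine Finset.sum_congr rfl fun m _ => ?_
  simp only [Fintype.sum_prod_type, h, map_smul, LinearMap.smul_apply, smul_eq_mul,
    Matrix.toBilin'_single]
  have hc := hU.col m m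
  rw [if_pos rfl] at hc
  have : ∀ i₀, ∑ a, U i₀ m * (U i₀ m * S m a a) = U i₀ m * U i₀ m * (S m).trace := by
    intro i₀
    simp only [Matrix.trace, Matrix.diag, Finset.mul_sum, mul_assoc]
  simp only [this, ← Finset.sum_mul, hc, one_mul]

end Lyapunov

/-! ### Laws of the links -/

section LinkLaw

theorem edgeWeight_mode {N : ℕ} {modes : Finset (Finset (Fin N × Fin N))} {Ω : Type*}
    (σ : ℕ → Ω → modes) (i j : Fin N) (k : ℕ) (ω : Ω) :
    edgeWeight (σ k ω : Finset (Fin N × Fin N)) i j =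
      {ω | link σ i j k ω = true}.indicator 1 ω := by
  simp [edgeWeight, link, Set.indicator_apply]

variable {N : ℕ} {modes : Finset (Finset (Fin N × Fin N))} {Ω : Type*} [MeasurableSpace Ω]
  {t : modes → modes → ℝ} {P : modes → Measure Ω} {σ : ℕ → Ω → modes}

theorem IsMarkovFamily.measurableSet_link (hσ : IsMarkovFamily t P σ) (i j : Fin N) (k : ℕ)
    (b : Bool) : MeasurableSet {ω | link σ i j k ω = b} := by
  let _ : MeasurableSpace modes := ⊤
  exact hσ.measurable_mode k (.of_discrete (s := {E : modes | decide ((i, j) ∈ E.1) = b}))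

theorem IsMarkovFamily.integral_edgeWeight (hσ : IsMarkovFamily t P σ) (Q : Measure Ω)
    (i j : Fin N) (k : ℕ) :
    ∫ ω, edgeWeight (σ k ω : Finset (Fin N × Fin N)) i j ∂Q =
      Q.real {ω | link σ i j k ω = true} := by
  simp only [edgeWeight_mode]
  exact integral_indicator_one (hσ.measurableSet_link i j k true)

theorem IsMarkovFamily.integral_edgeWeight_mul (hσ : IsMarkovFamily t P σ) {Q : Measure Ω}
    {i j r s : Fin N} {k : ℕ} (h : ProbabilityTheory.IndepFun (link σ i j k) (link σ r s k) Q) :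
    ∫ ω, edgeWeight (σ k ω : Finset (Fin N × Fin N)) i j *
        edgeWeight (σ k ω : Finset (Fin N × Fin N)) r s ∂Q =
      Q.real {ω | link σ i j k ω = true} * Q.real {ω | link σ r s k ω = true} := by
  have e : ∀ ω, edgeWeight (σ k ω : Finset (Fin N × Fin N)) i j *
      edgeWeight (σ k ω : Finset (Fin N × Fin N)) r s =
      ({ω | link σ i j k ω = true} ∩ {ω | link σ r s k ω = true}).indicator 1 ω := by
    intro ω
    rw [edgeWeight_mode, edgeWeight_mode, Set.inter_indicator_one]
    rfl
  simp only [e]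
  rw [integral_indicator_one ((hσ.measurableSet_link i j k true).inter
    (hσ.measurableSet_link r s k true))]
  have := h.measure_inter_preimage_eq_mul {true} {true} (.of_discrete) (.of_discrete)
  simp only [Measure.real, ← ENNReal.toReal_mul]
  exact congrArg ENNReal.toReal this

theorem IsMarkovFamily.integral_mixLaw_start (hσ : IsMarkovFamily t P σ) {μ : modes → ℝ}
    (hμ : ∀ i, 0 ≤ μ i) (f : modes → ℝ) :
    ∫ ω, f (σ 0 ω) ∂(mixLaw μ P) = ∑ i, μ i * f i := by
  have hint : ∀ i, Integrable (fun ω => f (σ 0 ω)) (P i) := fun i =>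
    hσ.integrable i (k := 0) (F := fun s => f (s 0)) fun s s' h =>
      congrArg f (h 0 (Set.mem_Iic.mpr le_rfl))
  rw [mixLaw, integral_finsetSum_measure fun i _ => (hint i).smul_measure ENNReal.ofReal_ne_top]
  refine Finset.sum_congr rfl fun i _ => ?_
  rw [integral_smul_measure, hσ.integral_start, ENNReal.toReal_ofReal (hμ i), smul_eq_mul]

/-- The success probabilities of the links at time one, given the initial mode `E`. -/
noncomputable def successProb (p q : Fin N → Fin N → ℝ) (E : Finset (Fin N × Fin N))
    (i j : Fin N) : ℝ :=
  if (i, j) ∈ E then p i j else q i j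

/-- The initial mode is almost surely constant, so that conditioning on the state of a link at time
zero changes nothing. -/
theorem HasLossLaw.real_link_one {E₀ : Finset (Fin N × Fin N)} {p q : Fin N → Fin N → ℝ}
    (hσ : IsMarkovFamily t P σ) {E : modes} (h : HasLossLaw E₀ p q σ (P E)) {i j : Fin N}
    (hij : (i, j) ∈ E₀) :
    (P E).real {ω | link σ i j 1 ω = true} = successProb p q E i j := by
  have := hσ.prob E
  have hcond : ∀ b : Bool, decide ((i, j) ∈ (E : Finset (Fin N × Fin N))) = b →
      P E {ω | link σ i j 0 ω = b} = 1 := by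
    intro b hb
    refine (prob_compl_eq_zero_iff (hσ.measurableSet_link i j 0 b)).mp (mem_ae_iff.mp ?_)
    filter_upwards [hσ.ae_start E] with ω hω
    simpa [link, hω] using hb
  have hreal : ∀ b : Bool, P E {ω | link σ i j 0 ω = b} = 1 →
      (ProbabilityTheory.cond (P E) {ω | link σ i j 0 ω = b}).real
        {ω | link σ i j 1 ω = true} = (P E).real {ω | link σ i j 1 ω = true} := by
    intro b hb
    have hae : {ω | link σ i j 0 ω = b} ∈ ae (P E) :=
      mem_ae_iff.mpr ((prob_compl_eq_zero_iff (hσ.measurableSet_link i j 0 b)).mpr hb)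
    rw [measureReal_def, ProbabilityTheory.cond_apply (hσ.measurableSet_link i j 0 b), hb,
      inv_one, one_mul]
    refine congrArg ENNReal.toReal (measure_congr ?_)
    filter_upwards [hae] with ω hω
    exact propext ⟨fun h => h.2, fun h => ⟨hω, h⟩⟩
  unfold successProb
  split_ifs with hE
  · have h1 := hcond true (by simpa using hE)
    rw [← hreal true h1]
    exact h.success i j hij 0 (by rw [h1]; exact one_ne_zero)
  · have h1 := hcond false (by simpa using hE)
    rw [← hreal false h1]
    exact h.failure i j hij 0 (by rw [h1]; exact one_ne_zero)

/-- Symmetric loss makes the two links of a pair agree almost surely; for Bernoulli loss the success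
probability does not depend on the initial mode. -/
theorem IsSymmetricLoss.successProb_symm {E₀ : Finset (Fin N × Fin N)}
    {p q η : Fin N → Fin N → ℝ} (hsymm : IsSymmetricLoss E₀ p q η P σ)
    (hσ : IsMarkovFamily t P σ) (hE₀ : IsUndirected E₀) {E : modes}
    (h : HasLossLaw E₀ p q σ (P E)) {i j : Fin N} (hij : (i, j) ∈ E₀) :
    successProb p q E i j = successProb p q E j i := by
  rcases hsymm.symm_or_bernoulli with hs | hb
  · rw [← h.real_link_one hσ hij, ← h.real_link_one hσ ((hE₀ i j).mp hij)]
    refine measureReal_congr ?_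
    filter_upwards [hs E 1 i j hij] with ω hω
    exact congrArg (· = true) hω
  · have h1 := hb i j hij
    have h2 := hb j i ((hE₀ i j).mp hij)
    simp only [successProb, ← h1, ← h2, ite_self]
    exact hsymm.symm_p i j hij

end LinkLaw

/-! ### The norm bound -/

theorem theorem4 {N nx nw nz : ℕ}
    -- nominal communication graph: undirected, without self-loops
    (E₀ : Finset (Fin N × Fin N)) (hloop : ∀ i, (i, i) ∉ E₀) (hE₀ : IsUndirected E₀)
    -- decomposable Markov jump linear system
    (modes : Finset (Finset (Fin N × Fin N)))
    (G : MJLS modes (Fin N × Fin nx) (Fin N × Fin nw) (Fin N × Fin nz))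
    (A : Components nx nx) (B : Components nx nw) (C : Components nz nx) (D : Components nz nw)
    (hG : IsDecomposable G E₀ A B C D)
    -- mode process and packet loss
    {Ω : Type*} [MeasurableSpace Ω] (P : modes → Measure Ω) (σ : ℕ → Ω → modes)
    (hσ : IsMarkovFamily G.t P σ)
    (p q η : Fin N → Fin N → ℝ)
    (hloss : IsMarkovLoss E₀ p q η G.μ P σ)
    (hsymm : IsSymmetricLoss E₀ p q η P σ)
    (ρl ρu : ℝ) (hρl : 0 ≤ ρl) (hρ : ρl ≤ ρu) (hρu : ρu ≤ 1)
    (hbound : ∀ i j, (i, j) ∈ E₀ →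
      p i j ∈ Set.Icc ρl ρu ∧ q i j ∈ Set.Icc ρl ρu ∧ η i j ∈ Set.Icc ρl ρu)
    -- eigenvalues of the nominal Laplacian
    (lam : Fin N → ℝ) (hlam : lam = hE₀.isHermitian_laplacian.eigenvalues)
    -- decision variables
    (γ : ℝ) (hγ : 0 < γ)
    (Y : Matrix (Fin nx) (Fin nx) ℝ) (hY : Y.PosDef)
    (Z : Fin N → Matrix (Fin nw) (Fin nw) ℝ) (hZ : ∀ i, (Z i).IsSymm)
    (hZtr : ∑ i, (Z i).trace < γ ^ 2)
    (P₁ P₂ : Matrix ((Fin 3 × (Fin nx ⊕ Fin nz)) ⊕ (Fin 2 × (Fin nx ⊕ Fin nz)))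
      ((Fin 3 × (Fin nx ⊕ Fin nz)) ⊕ (Fin 2 × (Fin nx ⊕ Fin nz))) ℝ)
    (hP₁ : P₁ ∈ multiplierSet (Fin nx ⊕ Fin nz) ρl ρu)
    (hP₂ : P₂ ∈ multiplierSet (Fin nx ⊕ Fin nz) ρl ρu)
    -- nominal inequalities
    (hnomG : ∀ i, lam i = 0 → NegDef (A.dᵀ * Y * A.d - Y + C.dᵀ * C.d))
    (hnomT : ∀ i, lam i = 0 → NegDef (B.dᵀ * Y * B.d - Z i + D.dᵀ * D.d))
    -- modal inequalities
    (hmodG : ∀ i, lam i ≠ 0 → NegDef (modalMatrix (lam i) Y (Matrix.fromBlocks Y 0 0 1)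
      (Matrix.fromRows A.d C.d) (Matrix.fromRows A.c C.c) (Matrix.fromRows A.p C.p) P₁))
    (hmodT : ∀ i, lam i ≠ 0 → NegDef (modalMatrix (lam i) (Z i) (Matrix.fromBlocks Y 0 0 1)
      (Matrix.fromRows B.d D.d) (Matrix.fromRows B.c D.c) (Matrix.fromRows B.p D.p) P₂)) :
    G.IsMeanSquareStable P σ ∧ G.h2Norm P σ < ENNReal.ofReal γ := by
  have hU := hE₀.isModalBasis
  rw [← hlam] at hU
  have hY' := hY.posSemidef
  have hsub : ∀ E : modes, (E : Finset (Fin N × Fin N)) ⊆ E₀ := fun E =>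
    hloss.modes_subset E E.2
  have hpair : ∀ i j l, (i, j) ∈ E₀ → j ≠ l → (i, j) ≠ (i, l) ∧ (i, l) ≠ (j, i) := by
    intro i j l hij hjl
    refine ⟨fun h => hjl (Prod.ext_iff.mp h).2, fun h => ?_⟩
    obtain rfl : i = j := (Prod.ext_iff.mp h).1
    exact hloop i hij
  -- The law of the mode at time one, given the initial mode `E`, decreases the form of `I ⊗ Y`.
  have hstep : ∀ (E : modes) (x : Fin N × Fin nx → ℝ), x ≠ 0 →
      ∑ E', G.t E E' * (agentForm Y (G.A E' *ᵥ x) + (G.C E' *ᵥ x) ⬝ᵥ (G.C E' *ᵥ x)) <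
        agentForm Y x := by
    intro E x hx
    simp only [hG.eq_A, hG.eq_C]
    rw [← hU.sum_agentForm Y x]
    refine (sum_weight_energy_le hE₀ hU hY' (fun _ => Y) A C hP₁ hρl hρu hnomG hmodG
      (fun E' : modes => (E' : Finset (Fin N × Fin N))) hsub (G.t E) (G.t_sum E)
      (successProb p q E) ?_ ?_ ?_ ?_ x).2 hx
    · intro i j hij
      unfold successProb
      split_ifs
      · exact (hbound i j hij).1
      · exact (hbound i j hij).2.1
    · exact fun i j hij => hsymm.successProb_symm hσ hE₀ (hloss.law E) hij
    · intro i j hij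
      rw [← (hloss.law E).real_link_one hσ hij, ← hσ.integral_edgeWeight]
      exact (hσ.integral_one E fun E' => edgeWeight (E' : Finset (Fin N × Fin N)) i j).symm
    · intro i j l hij hil hjl
      obtain ⟨h1, h2⟩ := hpair i j l hij hjl
      rw [← (hloss.law E).real_link_one hσ hij, ← (hloss.law E).real_link_one hσ hil,
        ← hσ.integral_edgeWeight_mul ((hloss.law E).indep i j i l hij hil h1 h2 1 1)]
      exact (hσ.integral_one E fun E' => edgeWeight (E' : Finset (Fin N × Fin N)) i j *
        edgeWeight (E' : Finset (Fin N × Fin N)) i l).symm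
  have hε : ∀ E : modes, ∃ ε : Set.Ioi (0 : ℝ), ∀ x : Fin N × Fin nx → ℝ,
      ε * (x ⬝ᵥ x) ≤ agentForm Y x -
        ∑ E', G.t E E' * (agentForm Y (G.A E' *ᵥ x) + (G.C E' *ᵥ x) ⬝ᵥ (G.C E' *ᵥ x)) := by
    intro E
    have hmul : ∀ {m : ℕ} (M : Matrix (Fin N × Fin m) (Fin N × Fin nx) ℝ),
        Continuous fun x => M *ᵥ x := fun M => by fun_prop
    have hcont : Continuous fun x : Fin N × Fin nx → ℝ => agentForm Y x -
        ∑ E', G.t E E' * (agentForm Y (G.A E' *ᵥ x) + (G.C E' *ᵥ x) ⬝ᵥ (G.C E' *ᵥ x)) :=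
      (continuous_agentForm Y).sub (continuous_finsetSum _ fun E' _ =>
        continuous_const.mul (((continuous_agentForm Y).comp (hmul _)).add
          ((hmul _).dotProduct (hmul _))))
    obtain ⟨ε, hε, h⟩ := exists_pos_mul_dotProduct_le _ hcont (fun c x => by
      simp only [Matrix.mulVec_smul, agentForm_smul, smul_dotProduct, dotProduct_smul,
        smul_eq_mul, mul_sub, Finset.mul_sum]
      congr 1
      exact Finset.sum_congr rfl fun E' _ => by ring) fun x hx => sub_pos.mpr (hstep E x hx)
    exact ⟨⟨ε, hε⟩, h⟩
  choose ε hε using hε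
  obtain ⟨⟨ε₀, hε₀⟩, hmin⟩ := Finite.exists_ge ε
  have hdec : ∀ (E : modes) (x : Fin N × Fin nx → ℝ),
      ∑ E', G.t E E' * (agentForm Y (G.A E' *ᵥ x) + (G.C E' *ᵥ x) ⬝ᵥ (G.C E' *ᵥ x)) +
        ε₀ * (x ⬝ᵥ x) ≤ agentForm Y x := by
    intro E x
    have h1 := hε E x
    have h2 : ε₀ * (x ⬝ᵥ x) ≤ ε E * (x ⬝ᵥ x) :=
      mul_le_mul_of_nonneg_right (hmin E) (real_dotProduct_self_nonneg x)
    linarith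
  refine ⟨G.isMeanSquareStable_of_lyapunov hσ (agentForm Y) (agentForm_nonneg hY') hε₀ hdec, ?_⟩
  -- The energy of the impulse responses, averaged with the initial distribution.
  set e : modes → Fin N × Fin nw → ℝ := fun E s =>
    agentForm Y (G.B E *ᵥ Pi.single s 1) +
      (G.D E *ᵥ Pi.single s 1) ⬝ᵥ (G.D E *ᵥ Pi.single s 1) with he
  have he0 : ∀ E s, 0 ≤ e E s := fun E s =>
    add_nonneg (agentForm_nonneg hY' _) (real_dotProduct_self_nonneg _)
  have henergy : ∀ s, ∑ E, G.μ E * e E s ≤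
      ∑ m, Matrix.toBilin' (Z m)
        (∑ i, hE₀.isHermitian_laplacian.eigenvectorBasis m i •
          fun b => (Pi.single s 1 : Fin N × Fin nw → ℝ) (i, b))
        (∑ i, hE₀.isHermitian_laplacian.eigenvectorBasis m i •
          fun b => (Pi.single s 1 : Fin N × Fin nw → ℝ) (i, b)) := by
    intro s
    simp only [he, hG.eq_B, hG.eq_D]
    refine (sum_weight_energy_le hE₀ hU hY' Z B D hP₂ hρl hρu hnomT hmodT
      (fun E : modes => (E : Finset (Fin N × Fin N))) hsub G.μ G.μ_sum η
      (fun i j hij => (hbound i j hij).2.2) hsymm.symm_η ?_ ?_ (Pi.single s 1)).1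
    · intro i j hij
      rw [← hloss.init i j hij, ← hσ.integral_edgeWeight]
      exact (hσ.integral_mixLaw_start G.μ_nonneg
        fun E => edgeWeight (E : Finset (Fin N × Fin N)) i j).symm
    · intro i j l hij hil hjl
      obtain ⟨h1, h2⟩ := hpair i j l hij hjl
      rw [← hloss.init i j hij, ← hloss.init i l hil,
        ← hσ.integral_edgeWeight_mul (hloss.law_mix.indep i j i l hij hil h1 h2 0 0)]
      exact (hσ.integral_mixLaw_start G.μ_nonneg
        fun E => edgeWeight (E : Finset (Fin N × Fin N)) i j *
          edgeWeight (E : Finset (Fin N × Fin N)) i l).symm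
  have htotal : ∑ E, ∑ s, ENNReal.ofReal (G.μ E) * G.impulseEnergy P σ s E <
      ENNReal.ofReal (γ ^ 2) := by
    calc ∑ E, ∑ s, ENNReal.ofReal (G.μ E) * G.impulseEnergy P σ s E
        ≤ ∑ E, ∑ s, ENNReal.ofReal (G.μ E * e E s) := by
          refine Finset.sum_le_sum fun E _ => Finset.sum_le_sum fun s _ => ?_
          rw [ENNReal.ofReal_mul (G.μ_nonneg E)]
          gcongr
          exact G.impulseEnergy_le hσ (agentForm Y) (agentForm_nonneg hY') (le_of_lt hε₀) hdec s E
      _ = ENNReal.ofReal (∑ s, ∑ E, G.μ E * e E s) := by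
          rw [Finset.sum_comm, ENNReal.ofReal_sum_of_nonneg fun s _ =>
            Finset.sum_nonneg fun E _ => mul_nonneg (G.μ_nonneg E) (he0 E s)]
          refine Finset.sum_congr rfl fun s _ => ?_
          rw [ENNReal.ofReal_sum_of_nonneg fun E _ => mul_nonneg (G.μ_nonneg E) (he0 E s)]
      _ ≤ ENNReal.ofReal (∑ m, (Z m).trace) := by
          refine ENNReal.ofReal_le_ofReal ?_
          rw [← hU.sum_single Z]
          exact Finset.sum_le_sum fun s _ => henergy s
      _ < ENNReal.ofReal (γ ^ 2) :=
          (ENNReal.ofReal_lt_ofReal_iff (by positivity)).mpr hZtr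
  have hγ2 : ENNReal.ofReal (γ ^ 2) ^ (1 / 2 : ℝ) = ENNReal.ofReal γ := by
    rw [ENNReal.ofReal_rpow_of_nonneg (sq_nonneg γ) (by norm_num), ← Real.sqrt_eq_rpow,
      Real.sqrt_sq hγ.le]
  rw [← hγ2]
  exact ENNReal.rpow_lt_rpow htotal (by norm_num)
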